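/- **Lemma (Entropy flux kernel).** Let $0<\varepsilon<1$. In terms of the Riemann invariants $(w,z)\in\mathbb R^2$, consider the isothermal relativistic Euler equations (sound speed $1$, light speed $1/\varepsilon$), where $\bar u(v)=\frac{w+z}2$ and $\rho=e^{(1+\varepsilon^2)(w-z)/2}$. Their characteristic speeds are $$\lambda_1(w,z)=-\frac1\varepsilon\,\frac{1+\varepsilon-(1-\varepsilon)e^{\varepsilon(w+z)}}{1+\varepsilon+(1-\varepsilon)e^{\varepsilon(w+z)}},\qquad \lambda_2(w,z)=-\frac1\varepsilon\,\frac{1-\varepsilon-(1+\varepsilon)e^{\varepsilon(w+z)}}{1-\varepsilon+(1+\varepsilon)e^{\varepsilon(w+z)}}.$$ Put $$\bar a(\xi)=-\frac{1-\varepsilon^2}4\,\frac{1-\varepsilon+(1+\varepsilon)e^{\varepsilon\xi}}{1+\varepsilon+(1-\varepsilon)e^{\varepsilon\xi}},\qquad \bar b(\xi)=-\bar a(-\xi).$$ There is exactly one Riemann function $\mathcal R(w',z';w,z)$, that is, for every $(w,z)$ the map $(w',z')\mapsto\mathcal R(w',z';w,z)$ is of class $C^2$ on $\mathbb R^2$ and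 solves the Goursat problem $$\mathcal R_{w'z'}-(\bar b(w'+z')\mathcal R)_{w'}-(\bar a(w'+z')\mathcal R)_{z'}=0,$$ $$\mathcal R_{w'}=\bar a(w'+z)\,\mathcal R\ \text{ on } z'=z,\qquad \mathcal R_{z'}=\bar b(w+z')\,\mathcal R\ \text{ on } w'=w,\qquad \mathcal R(w,z;w,z)=1,$$ and $(w,z)\mapsto\mathcal R(0,0;w,z)$ is $C^\infty$ on $\mathbb R^2$. Let the entropy kernel be $\chi(w,z)=\mathcal R(0,0;w,z)$ for $wz\le0$ and $\chi(w,z)=0$ for $wz>0$, and let $C_1(w,z)=\partial_w\mathcal R(0,0;w,z)$ and $C_2(w,z)=\partial_z\mathcal R(0,0;w,z)$, which on $\{wz<0\}$ are the regular parts of $\chi_w$ and $\chi_z$. There is a locally integrable function $\sigma$ on $\{w\ne z\}$, unique up to null sets, such that $$\sigma_w=\lambda_2\,\chi_w,\qquad \sigma_z=\lambda_1\,\chi_z$$ in the sense of distributions in each of the regions $\rho<1$ (i.e. $w<z$) and $\rho>1$ (i.e. $w>z$), and such that $\sigma^\sharp:=\sigma-\bar u(v)\,\chi=\sigma-\frac{w+z}2\,\chi$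 satisfies $\sigma^\sharp(0,0)=0$, meaning that $\sigma^\sharp(w,z)\to0$ as $(w,z)\to(0,0)$ within $\{wz<0\}$. Moreover, in the sense of distributions in each of the regions $\rho<1$ and $\rho>1$, $$\sigma^\sharp_w=C_5(z)\,e^{-(1+\varepsilon)^2z/4}\,\delta_{w=0}+C_3(w,z)\,\mathbf 1_{wz<0},$$ $$\sigma^\sharp_z=C_6(w)\,e^{(1-\varepsilon)^2w/4}\,\delta_{z=0}+C_4(w,z)\,\mathbf 1_{wz<0},$$ where $$C_3=\Big(\lambda_2-\frac{w+z}2\Big)C_1-\frac12\chi,\qquad C_4=\Big(\lambda_1-\frac{w+z}2\Big)C_2-\frac12\chi,$$ $$C_5(z)=|z|\,\frac{1-\varepsilon+(1+\varepsilon)e^{\varepsilon z}}4+(\operatorname{sgn}z)\,\frac{1-\varepsilon-(1+\varepsilon)e^{\varepsilon z}}{2\varepsilon},$$ $$C_6(w)=|w|\,\frac{1+\varepsilon+(1-\varepsilon)e^{\varepsilon w}}4+(\operatorname{sgn}w)\,\frac{1+\varepsilon-(1-\varepsilon)e^{\varepsilon w}}{2\varepsilon}.$$ -/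

import Mathlib

open MeasureTheory Filter Topology
open scoped ContDiff

namespace RelEuler

noncomputable section

/-- The slow characteristic speed as a function of the Riemann invariants `w, z`; it equals
`(v - 1) / (1 - ε ^ 2 * v)` for the velocity `v = tanh (ε * (w + z) / 2) / ε`. -/
def lam1 (ε w z : ℝ) : ℝ :=
  -(1 / ε) * ((1 + ε - (1 - ε) * Real.exp (ε * (w + z))) /
    (1 + ε + (1 - ε) * Real.exp (ε * (w + z))))

/-- The fast characteristic speed; it equals `(v + 1) / (1 + ε ^ 2 * v)`. -/
def lam2 (ε w z : ℝ) : ℝ :=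
  -(1 / ε) * ((1 - ε - (1 + ε) * Real.exp (ε * (w + z))) /
    (1 - ε + (1 + ε) * Real.exp (ε * (w + z))))

/-- The coefficient of `U_z` in the entropy equation `U_wz + b (w+z) U_w + a (w+z) U_z = 0`. -/
def aBar (ε ξ : ℝ) : ℝ :=
  -((1 - ε ^ 2) / 4) * ((1 - ε + (1 + ε) * Real.exp (ε * ξ)) /
    (1 + ε + (1 - ε) * Real.exp (ε * ξ)))

/-- The coefficient of `U_w` in the entropy equation `U_wz + b (w+z) U_w + a (w+z) U_z = 0`. -/
def bBar (ε ξ : ℝ) : ℝ :=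
  ((1 - ε ^ 2) / 4) * ((1 + ε + (1 - ε) * Real.exp (ε * ξ)) /
    (1 - ε + (1 + ε) * Real.exp (ε * ξ)))

/-- `R x y w z` is the Riemann function `R(x, y; w, z)` of the entropy equation: for every pole
`(w, z)` the map `(x, y) ↦ R(x, y; w, z)` is a classical solution on the whole plane of the
Goursat problem for the adjoint equation. -/
structure IsRiemannFunction (ε : ℝ) (R : ℝ → ℝ → ℝ → ℝ → ℝ) : Prop where
  contDiff : ∀ w z, ContDiff ℝ 2 (fun p : ℝ × ℝ => R p.1 p.2 w z)
  adjoint_eq : ∀ w z x y,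
    deriv (fun y' => deriv (fun x' => R x' y' w z) x) y
      - deriv (fun x' => bBar ε (x' + y) * R x' y w z) x
      - deriv (fun y' => aBar ε (x + y') * R x y' w z) y = 0
  on_line_z : ∀ w z x, deriv (fun x' => R x' z w z) x = aBar ε (x + z) * R x z w z
  on_line_w : ∀ w z y, deriv (fun y' => R w y' w z) y = bBar ε (w + y) * R w y w z
  at_pole : ∀ w z, R w z w z = 1

/-- The entropy kernel: `R(0, 0; w, z)` where `w z ≤ 0`, and `0` where `w z > 0`. -/
def entropyKernel (R : ℝ → ℝ → ℝ → ℝ → ℝ) (p : ℝ × ℝ) : ℝ :=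
  open Classical in if p.1 * p.2 ≤ 0 then R 0 0 p.1 p.2 else 0

/-- The function `C₁(w, z) = ∂_w R(0, 0; w, z)`, the regular part of `χ_w` on `{w z < 0}`. -/
def C1 (R : ℝ → ℝ → ℝ → ℝ → ℝ) (p : ℝ × ℝ) : ℝ := deriv (fun w => R 0 0 w p.2) p.1

/-- The function `C₂(w, z) = ∂_z R(0, 0; w, z)`, the regular part of `χ_z` on `{w z < 0}`. -/
def C2 (R : ℝ → ℝ → ℝ → ℝ → ℝ) (p : ℝ × ℝ) : ℝ := deriv (fun z => R 0 0 p.1 z) p.2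

def C3 (ε : ℝ) (R : ℝ → ℝ → ℝ → ℝ → ℝ) (p : ℝ × ℝ) : ℝ :=
  (lam2 ε p.1 p.2 - (p.1 + p.2) / 2) * C1 R p - 1 / 2 * entropyKernel R p

def C4 (ε : ℝ) (R : ℝ → ℝ → ℝ → ℝ → ℝ) (p : ℝ × ℝ) : ℝ :=
  (lam1 ε p.1 p.2 - (p.1 + p.2) / 2) * C2 R p - 1 / 2 * entropyKernel R p

def C5 (ε z : ℝ) : ℝ :=
  |z| * ((1 - ε + (1 + ε) * Real.exp (ε * z)) / 4)
    + Real.sign z * ((1 - ε - (1 + ε) * Real.exp (ε * z)) / (2 * ε))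

def C6 (ε w : ℝ) : ℝ :=
  |w| * ((1 + ε + (1 - ε) * Real.exp (ε * w)) / 4)
    + Real.sign w * ((1 + ε - (1 - ε) * Real.exp (ε * w)) / (2 * ε))

/-- The union of the regions `ρ < 1` (where `w < z`) and `ρ > 1` (where `w > z`). -/
def nonunitDensity : Set (ℝ × ℝ) := {p | p.1 ≠ p.2}

/-- Smooth test functions with compact support in the open set `Ω`. -/
structure IsTestFunction (Ω : Set (ℝ × ℝ)) (φ : ℝ × ℝ → ℝ) : Prop where
  contDiff : ContDiff ℝ ∞ φ
  hasCompactSupport : HasCompactSupport φ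
  tsupport_subset : tsupport φ ⊆ Ω

/-- Partial derivative with respect to `w`. -/
def dw (φ : ℝ × ℝ → ℝ) (p : ℝ × ℝ) : ℝ := deriv (fun w => φ (w, p.2)) p.1

/-- Partial derivative with respect to `z`. -/
def dz (φ : ℝ × ℝ → ℝ) (p : ℝ × ℝ) : ℝ := deriv (fun z => φ (p.1, z)) p.2

/-- The modified flux kernel `σ♯ = σ - u χ`, where `u = (w + z) / 2` is `ubar(v)`. -/
def sharp (χ σ : ℝ × ℝ → ℝ) (p : ℝ × ℝ) : ℝ := σ p - (p.1 + p.2) / 2 * χ p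

/-- `σ` is an entropy flux kernel associated with the entropy kernel `χ`, normalised at the origin.
The two equations say that `σ_w = λ₂ χ_w` and `σ_z = λ₁ χ_z` in the sense of distributions in each
of the regions `ρ < 1` and `ρ > 1`; the value of `σ♯` at the origin is the limit from the inside
`{w z < 0}` of the support of `χ`. -/
structure IsEntropyFluxKernel (ε : ℝ) (χ σ : ℝ × ℝ → ℝ) : Prop where
  locallyIntegrableOn : LocallyIntegrableOn σ nonunitDensity
  eq_w : ∀ φ, IsTestFunction nonunitDensity φ →
    -∫ p, σ p * dw φ p = -∫ p, χ p * dw (fun q => lam2 ε q.1 q.2 * φ q) p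
  eq_z : ∀ φ, IsTestFunction nonunitDensity φ →
    -∫ p, σ p * dz φ p = -∫ p, χ p * dz (fun q => lam1 ε q.1 q.2 * φ q) p
  sharp_zero : Tendsto (sharp χ σ) (𝓝[{p : ℝ × ℝ | p.1 * p.2 < 0}] (0, 0)) (𝓝 0)

end

end RelEuler

/-!
Green's formula gives Riemann's reciprocity law: as a function of the pole, the Riemann function
`R(w', z'; ·)` is the solution `u` of the Goursat problem for the entropy equation
`u_wz + b u_w + a u_z = 0` with pole `(w', z')`. Such a `u` exists and is smooth, because weights
hidden in `a` and `b` reduce the system for `(u_w, u_z)` to the telegraph equation, and a reflection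
turns `u` into a solution of the adjoint problem.

Since `λ₁' = -a (λ₂ - λ₁)` and `λ₂' = b (λ₂ - λ₁)` as functions of `w + z`, the entropy equation
says precisely that `λ₂ u_w dw + λ₁ u_z dz` is closed. For the pole at the origin, its potential `F`
with `F(0, 0) = 0` is `λ₂ u - 1` on the axis `w = 0` and `λ₁ u + 1` on `z = 0`, so the jumps of the
kernel across the axes are matched by extending `F` by `±1` on each of the four components of
`w z > 0`, `w ≠ z`. Two flux kernels differ by a constant on each of the half-planes `w < z` and
`w > z`, which are convex cones, and the normalisation at the origin makes that constant zero.
-/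

namespace RelEuler

/-! ### Exponential generating functions -/

/-- The exponential generating function `∑ c n * t ^ n / n!` of a real sequence `c`; it is entire
as soon as `c` is bounded. -/
noncomputable def expGenFun (c : ℕ → ℝ) (t : ℝ) : ℝ := ∑' n : ℕ, c n * (t ^ n / n.factorial)

section ExpGenFun

variable {c : ℕ → ℝ} {C : ℝ}

lemma summable_expGenFun (hc : ∀ n, |c n| ≤ C) (t : ℝ) :
    Summable fun n : ℕ => c n * (t ^ n / n.factorial) := by
  refine ((Real.summable_pow_div_factorial |t|).mul_left C).of_norm_bounded fun n => ?_
  rw [norm_mul, norm_div, norm_pow, Real.norm_eq_abs, Real.norm_eq_abs, RCLike.norm_natCast]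
  gcongr
  exact hc n

lemma expGenFun_eq_add (hc : ∀ n, |c n| ≤ C) (t : ℝ) :
    expGenFun c t = c 0 + ∑' n : ℕ, c (n + 1) * (t ^ (n + 1) / (n + 1).factorial) := by
  rw [expGenFun, (summable_expGenFun hc t).tsum_eq_zero_add]
  simp

lemma expGenFun_apply_zero (hc : ∀ n, |c n| ≤ C) : expGenFun c 0 = c 0 := by
  simp [expGenFun_eq_add hc]

lemma hasDerivAt_pow_div_factorial (n : ℕ) (t : ℝ) :
    HasDerivAt (fun t : ℝ => t ^ (n + 1) / (n + 1).factorial) (t ^ n / n.factorial) t := by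
  refine ((hasDerivAt_pow (n + 1) t).div_const _).congr_deriv ?_
  rw [Nat.factorial_succ, Nat.cast_mul, Nat.add_sub_cancel]
  field_simp

lemma hasDerivAt_expGenFun (hc : ∀ n, |c n| ≤ C) (t : ℝ) :
    HasDerivAt (expGenFun c) (expGenFun (fun n => c (n + 1)) t) t := by
  have hbound (n : ℕ) (y : ℝ) (hy : y ∈ Metric.ball 0 (|t| + 1)) :
      ‖c (n + 1) * (y ^ n / n.factorial)‖ ≤ C * ((|t| + 1) ^ n / n.factorial) := by
    rw [norm_mul, norm_div, norm_pow, RCLike.norm_natCast]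
    gcongr
    · exact (abs_nonneg _).trans (hc 0)
    · exact hc (n + 1)
    · exact (mem_ball_zero_iff.1 hy).le
  have htail := hasDerivAt_tsum_of_isPreconnected
    ((Real.summable_pow_div_factorial (|t| + 1)).mul_left C) Metric.isOpen_ball
    (convex_ball _ _).isPreconnected
    (fun n y _ => (hasDerivAt_pow_div_factorial n y).const_mul (c (n + 1))) hbound
    (Metric.mem_ball_self (by positivity)) ((summable_nat_add_iff 1).2 (summable_expGenFun hc 0))
    (show t ∈ Metric.ball 0 (|t| + 1) by simp)
  rw [funext (expGenFun_eq_add hc)]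
  exact htail.const_add (c 0)

lemma contDiff_expGenFun (hc : ∀ n, |c n| ≤ C) : ContDiff ℝ ∞ (expGenFun c) := by
  refine contDiff_infty.2 fun n => ?_
  induction n generalizing c with
  | zero =>
    exact contDiff_zero.2 (Differentiable.continuous fun t =>
      (hasDerivAt_expGenFun hc t).differentiableAt)
  | succ n ih =>
    push_cast
    rw [contDiff_succ_iff_deriv, funext fun t => (hasDerivAt_expGenFun hc t).deriv]
    exact ⟨fun t => (hasDerivAt_expGenFun hc t).differentiableAt, by simp, ih fun n => hc (n + 1)⟩

end ExpGenFun

/-- The entire function `∑ t ^ n / (n! (n + k)!)`, which is `t ^ (-k / 2) I_k (2 √t)` for the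
modified Bessel function `I_k`. -/
noncomputable def besselSeries (k : ℕ) : ℝ → ℝ := expGenFun fun n => ((n + k).factorial : ℝ)⁻¹

lemma abs_inv_factorial_le_one (n : ℕ) : |((n.factorial : ℝ))⁻¹| ≤ 1 := by
  rw [abs_inv, Nat.abs_cast]
  exact inv_le_one_of_one_le₀ (mod_cast n.factorial_pos)

lemma contDiff_besselSeries (k : ℕ) : ContDiff ℝ ∞ (besselSeries k) :=
  contDiff_expGenFun fun n => abs_inv_factorial_le_one (n + k)

lemma hasDerivAt_besselSeries (k : ℕ) (t : ℝ) :
    HasDerivAt (besselSeries k) (besselSeries (k + 1) t) t := by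
  refine (hasDerivAt_expGenFun (fun n => abs_inv_factorial_le_one (n + k)) t).congr_deriv ?_
  simp only [besselSeries, Nat.add_right_comm _ 1 k, Nat.add_assoc]

lemma besselSeries_zero_apply_zero : besselSeries 0 0 = 1 :=
  (expGenFun_apply_zero fun n => abs_inv_factorial_le_one (n + 0)).trans (by simp)

lemma besselSeries_recurrence (t : ℝ) :
    t * besselSeries 2 t + besselSeries 1 t = besselSeries 0 t := by
  have hbdd (k n : ℕ) := abs_inv_factorial_le_one (n + k)
  simp only [besselSeries, expGenFun_eq_add (hbdd 1), expGenFun_eq_add (hbdd 0)]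
  rw [expGenFun, ← tsum_mul_left, add_left_comm, ← Summable.tsum_add
    ((summable_expGenFun (hbdd 2) t).mul_left t)
    ((summable_nat_add_iff 1).2 (summable_expGenFun (hbdd 1) t))]
  congr 1
  refine tsum_congr fun n => ?_
  rw [Nat.add_zero, Nat.factorial_succ (n + 1), Nat.factorial_succ n]
  push_cast
  field_simp
  ring

/-! ### Partial derivatives in the plane -/

section PartialDerivatives

variable {G : ℝ × ℝ → ℝ} {x : ℝ × ℝ}

lemma hasDerivAt_dw (hG : DifferentiableAt ℝ G x) :
    HasDerivAt (fun w => G (w, x.2)) (dw G x) x.1 :=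
  (hG.comp x.1 (f := fun w => (w, x.2)) (by fun_prop)).hasDerivAt

lemma hasDerivAt_dz (hG : DifferentiableAt ℝ G x) :
    HasDerivAt (fun z => G (x.1, z)) (dz G x) x.2 :=
  (hG.comp x.2 (f := fun z => (x.1, z)) (by fun_prop)).hasDerivAt

lemma dw_eq_fderiv (hG : Differentiable ℝ G) : dw G = fun x => fderiv ℝ G x (1, 0) :=
  funext fun x => ((hG x).hasFDerivAt.comp_hasDerivAt x.1 (f := fun w => (w, x.2))
    ((hasDerivAt_id _).prodMk (hasDerivAt_const _ _))).deriv

lemma dz_eq_fderiv (hG : Differentiable ℝ G) : dz G = fun x => fderiv ℝ G x (0, 1) :=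
  funext fun x => ((hG x).hasFDerivAt.comp_hasDerivAt x.2 (f := fun z => (x.1, z))
    ((hasDerivAt_const _ _).prodMk (hasDerivAt_id _))).deriv

lemma fderiv_eq_dw_dz (hG : Differentiable ℝ G) :
    fderiv ℝ G = fun x =>
      dw G x • ContinuousLinearMap.fst ℝ ℝ ℝ + dz G x • ContinuousLinearMap.snd ℝ ℝ ℝ := by
  ext x <;> simp [dw_eq_fderiv hG, dz_eq_fderiv hG]

lemma dw_comp_add_mul {c : ℝ → ℝ} {c' : ℝ} (hc : HasDerivAt c c' (x.1 + x.2))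
    (hG : DifferentiableAt ℝ G x) :
    dw (fun y => c (y.1 + y.2) * G y) x = c' * G x + c (x.1 + x.2) * dw G x :=
  ((hc.comp_add_const x.1 x.2).mul (hasDerivAt_dw hG)).deriv

lemma dz_comp_add_mul {c : ℝ → ℝ} {c' : ℝ} (hc : HasDerivAt c c' (x.1 + x.2))
    (hG : DifferentiableAt ℝ G x) :
    dz (fun y => c (y.1 + y.2) * G y) x = c' * G x + c (x.1 + x.2) * dz G x :=
  ((hc.comp_const_add x.1 x.2).mul (hasDerivAt_dz hG)).deriv

lemma contDiff_dw {n : WithTop ℕ∞} (hG : ContDiff ℝ (n + 1) G) : ContDiff ℝ n (dw G) := by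
  rw [dw_eq_fderiv (hG.differentiable (by simp))]
  exact (hG.fderiv_right le_rfl).clm_apply contDiff_const

lemma contDiff_dz {n : WithTop ℕ∞} (hG : ContDiff ℝ (n + 1) G) : ContDiff ℝ n (dz G) := by
  rw [dz_eq_fderiv (hG.differentiable (by simp))]
  exact (hG.fderiv_right le_rfl).clm_apply contDiff_const

lemma contDiff_infty_of_dw_dz (hG : Differentiable ℝ G) (hw : ContDiff ℝ ∞ (dw G))
    (hz : ContDiff ℝ ∞ (dz G)) : ContDiff ℝ ∞ G := by
  refine contDiff_infty_iff_fderiv.2 ⟨hG, ?_⟩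
  rw [fderiv_eq_dw_dz hG]
  exact (hw.smul contDiff_const).add (hz.smul contDiff_const)

lemma dz_dw_comm (hG : ContDiff ℝ 2 G) (x : ℝ × ℝ) : dz (dw G) x = dw (dz G) x := by
  have hdG := hG.differentiable two_ne_zero
  have hd2G : Differentiable ℝ (fderiv ℝ G) :=
    (hG.fderiv_right (m := 1) le_rfl).differentiable one_ne_zero
  have hsymm : IsSymmSndFDerivAt ℝ G x := hG.contDiffAt.isSymmSndFDerivAt (by simp)
  rw [dw_eq_fderiv hdG, dz_eq_fderiv hdG, dz_eq_fderiv (hd2G.clm_apply (differentiable_const _)),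
    dw_eq_fderiv (hd2G.clm_apply (differentiable_const _))]
  simpa [fderiv_clm_apply (hd2G x) (differentiableAt_const _)] using hsymm (0, 1) (1, 0)

/-- The Poincaré lemma for one-forms in the plane. -/
lemma exists_dw_eq_dz_eq {p q : ℝ × ℝ → ℝ} (hp : Differentiable ℝ p) (hq : Differentiable ℝ q)
    (h : ∀ x, dz p x = dw q x) : ∃ G, Differentiable ℝ G ∧ dw G = p ∧ dz G = q := by
  have hω (x : ℝ × ℝ) : HasFDerivAt (fun x => p x • ContinuousLinearMap.fst ℝ ℝ ℝ +
      q x • ContinuousLinearMap.snd ℝ ℝ ℝ) _ x :=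
    ((hp x).hasFDerivAt.smul_const (ContinuousLinearMap.fst ℝ ℝ ℝ)).add
      ((hq x).hasFDerivAt.smul_const (ContinuousLinearMap.snd ℝ ℝ ℝ))
  obtain ⟨G, hG⟩ := convex_univ.exists_forall_hasFDerivAt_of_fderiv_symmetric
    isOpen_univ (fun x _ => (hω x).differentiableAt.differentiableWithinAt) fun x _ u v => by
      rw [(hω x).fderiv, fderiv_eq_dw_dz hp, fderiv_eq_dw_dz hq]
      simp only [h x, add_apply, ContinuousLinearMap.smulRight_apply, smul_apply,
        ContinuousLinearMap.coe_fst', smul_eq_mul, ContinuousLinearMap.coe_snd']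
      ring
  have hdG : Differentiable ℝ G := fun x => (hG x trivial).differentiableAt
  refine ⟨G, hdG, funext fun x => ?_, funext fun x => ?_⟩
  · simp [dw_eq_fderiv hdG, (hG x trivial).fderiv]
  · simp [dz_eq_fderiv hdG, (hG x trivial).fderiv]

lemma eq_of_hasDerivAt_eq {f g f' : ℝ → ℝ} (hf : ∀ t, HasDerivAt f (f' t) t)
    (hg : ∀ t, HasDerivAt g (f' t) t) {t₀ : ℝ} (h₀ : f t₀ = g t₀) : f = g :=
  eq_of_fderiv_eq (𝕜 := ℝ) (fun t => (hf t).differentiableAt) (fun t => (hg t).differentiableAt)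
    (fun t => (hf t).hasFDerivAt.fderiv.trans (hg t).hasFDerivAt.fderiv.symm) t₀ h₀

lemma eq_of_hasDerivAt_mul {f g c : ℝ → ℝ} (hf : ∀ t, HasDerivAt f (c t * f t) t)
    (hg : ∀ t, HasDerivAt g (c t * g t) t) (hg₀ : ∀ t, g t ≠ 0) {t₀ : ℝ} (h₀ : f t₀ = g t₀) :
    f = g := by
  have hdiv (t : ℝ) : HasDerivAt (fun t => f t / g t) 0 t :=
    ((hf t).div (hg t) (hg₀ t)).congr_deriv (by ring)
  ext t
  have hone : f t / g t = f t₀ / g t₀ :=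
    is_const_of_deriv_eq_zero (fun t => (hdiv t).differentiableAt) (fun t => (hdiv t).deriv) t t₀
  rwa [h₀, div_self (hg₀ t₀), div_eq_one_iff_eq (hg₀ t)] at hone

lemma apply_eq_of_dw_eq_zero (hG : Differentiable ℝ G) {z : ℝ} (h : ∀ w, dw G (w, z) = 0)
    (w w' : ℝ) : G (w, z) = G (w', z) :=
  is_const_of_deriv_eq_zero (f := fun w => G (w, z)) (by fun_prop) h w w'

lemma apply_eq_of_dz_eq_zero (hG : Differentiable ℝ G) {w : ℝ} (h : ∀ z, dz G (w, z) = 0)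
    (z z' : ℝ) : G (w, z) = G (w, z') :=
  is_const_of_deriv_eq_zero (f := fun z => G (w, z)) (by fun_prop) h z z'

end PartialDerivatives

/-! ### The Goursat problem and its adjoint -/

/-- Classical solutions on the whole plane of the Goursat problem for
`u_wz + b (w + z) u_w + a (w + z) u_z = 0` with pole `(w₀, z₀)`. The Riemann function
`R(w', z'; w, z)` of the adjoint problem solves it as a function of `(w, z)`. -/
structure IsGoursatSolution (a b : ℝ → ℝ) (w₀ z₀ : ℝ) (u : ℝ × ℝ → ℝ) : Prop where
  contDiff : ContDiff ℝ 2 u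
  eq : ∀ x, dz (dw u) x + b (x.1 + x.2) * dw u x + a (x.1 + x.2) * dz u x = 0
  on_line_z : ∀ w, dw u (w, z₀) = -a (w + z₀) * u (w, z₀)
  on_line_w : ∀ z, dz u (w₀, z) = -b (w₀ + z) * u (w₀, z)
  at_pole : u (w₀, z₀) = 1

/-- Classical solutions on the whole plane of the Goursat problem for the adjoint equation
`v_wz - (b (w + z) v)_w - (a (w + z) v)_z = 0` with pole `(w₀, z₀)`. -/
structure IsAdjointGoursatSolution (a b : ℝ → ℝ) (w₀ z₀ : ℝ) (v : ℝ × ℝ → ℝ) : Prop where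
  contDiff : ContDiff ℝ 2 v
  eq : ∀ x, dz (dw v) x - dw (fun y => b (y.1 + y.2) * v y) x
    - dz (fun y => a (y.1 + y.2) * v y) x = 0
  on_line_z : ∀ w, dw v (w, z₀) = a (w + z₀) * v (w, z₀)
  on_line_w : ∀ z, dz v (w₀, z) = b (w₀ + z) * v (w₀, z)
  at_pole : v (w₀, z₀) = 1

lemma isRiemannFunction_iff {ε : ℝ} {R : ℝ → ℝ → ℝ → ℝ → ℝ} :
    IsRiemannFunction ε R ↔ ∀ w z,
      IsAdjointGoursatSolution (aBar ε) (bBar ε) w z fun x => R x.1 x.2 w z :=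
  ⟨fun h w z => ⟨h.contDiff w z, fun x => h.adjoint_eq w z x.1 x.2, h.on_line_z w z,
      h.on_line_w w z, h.at_pole w z⟩,
    fun h => ⟨fun w z => (h w z).contDiff, fun w z x y => (h w z).eq (x, y),
      fun w z => (h w z).on_line_z, fun w z => (h w z).on_line_w, fun w z => (h w z).at_pole⟩⟩

section Goursat

variable {a b : ℝ → ℝ} {w₀ z₀ w z : ℝ} {u v : ℝ × ℝ → ℝ}

namespace IsGoursatSolution

lemma differentiable (hu : IsGoursatSolution a b w₀ z₀ u) : Differentiable ℝ u :=
  hu.contDiff.differentiable two_ne_zero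

lemma differentiable_dw (hu : IsGoursatSolution a b w₀ z₀ u) : Differentiable ℝ (dw u) :=
  (contDiff_dw (n := 1) hu.contDiff).differentiable one_ne_zero

lemma differentiable_dz (hu : IsGoursatSolution a b w₀ z₀ u) : Differentiable ℝ (dz u) :=
  (contDiff_dz (n := 1) hu.contDiff).differentiable one_ne_zero

end IsGoursatSolution

lemma IsAdjointGoursatSolution.differentiable (hv : IsAdjointGoursatSolution a b w z v) :
    Differentiable ℝ v :=
  hv.contDiff.differentiable two_ne_zero

lemma IsAdjointGoursatSolution.differentiable_dw (hv : IsAdjointGoursatSolution a b w z v) :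
    Differentiable ℝ (dw v) :=
  (contDiff_dw (n := 1) hv.contDiff).differentiable one_ne_zero

/-- A potential of the closed one-form given by Green's formula for the equation and its
adjoint. -/
lemma exists_green_potential (ha : Differentiable ℝ a) (hb : Differentiable ℝ b)
    (hu : IsGoursatSolution a b w₀ z₀ u) (hv : IsAdjointGoursatSolution a b w z v) :
    ∃ G, Differentiable ℝ G ∧
      (dw G = fun x => u x * (a (x.1 + x.2) * v x - dw v x)) ∧
      dz G = fun x => -v x * (dz u x + b (x.1 + x.2) * u x) := by
  have hdu := hu.differentiable
  have hduz := hu.differentiable_dz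
  have hdv := hv.differentiable
  have hdvw := hv.differentiable_dw
  refine exists_dw_eq_dz_eq (by fun_prop) (by fun_prop) fun x => ?_
  have hav : Differentiable ℝ fun y : ℝ × ℝ => a (y.1 + y.2) * v y := by fun_prop
  have hp : dz (fun y => u y * (a (y.1 + y.2) * v y - dw v y)) x =
      dz u x * (a (x.1 + x.2) * v x - dw v x) +
        u x * (dz (fun y => a (y.1 + y.2) * v y) x - dz (dw v) x) :=
    ((hasDerivAt_dz (hdu x)).mul
      ((hasDerivAt_dz (hav x)).sub (hasDerivAt_dz (hdvw x)))).deriv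
  have hq : dw (fun y => -v y * (dz u y + b (y.1 + y.2) * u y)) x =
      -dw v x * (dz u x + b (x.1 + x.2) * u x) +
        -v x * (dw (dz u) x + (deriv b (x.1 + x.2) * u x + b (x.1 + x.2) * dw u x)) :=
    ((hasDerivAt_dw (hdv x)).neg.mul ((hasDerivAt_dw (hduz x)).add
      (((hb _).hasDerivAt.comp_add_const x.1 x.2).mul (hasDerivAt_dw (hdu x))))).deriv
  have hveq := hv.eq x
  rw [dw_comp_add_mul (hb _).hasDerivAt (hdv x)] at hveq
  rw [hp, hq, ← dz_dw_comm hu.contDiff]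
  linear_combination v x * hu.eq x - u x * hveq

/-- Riemann's reciprocity law. -/
lemma IsAdjointGoursatSolution.apply_eq_apply (ha : Differentiable ℝ a) (hb : Differentiable ℝ b)
    (hv : IsAdjointGoursatSolution a b w z v) (hu : IsGoursatSolution a b w₀ z₀ u) :
    v (w₀, z₀) = u (w, z) := by
  obtain ⟨G, hG, hGw, hGz⟩ := exists_green_potential ha hb hu hv
  have hdu := hu.differentiable
  have hdv := hv.differentiable
  have hGuv : Differentiable ℝ fun x => G x + u x * v x := hG.add (hdu.mul hdv)
  have hdw (x : ℝ × ℝ) : dw (fun x => G x + u x * v x) x =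
      v x * (dw u x + a (x.1 + x.2) * u x) := by
    refine ((hasDerivAt_dw (hG x)).add
      ((hasDerivAt_dw (hdu x)).mul (hasDerivAt_dw (hdv x)))).deriv.trans ?_
    rw [hGw]
    ring
  have hdz (x : ℝ × ℝ) : dz (fun x => G x + u x * v x) x =
      u x * (dz v x - b (x.1 + x.2) * v x) := by
    refine ((hasDerivAt_dz (hG x)).add
      ((hasDerivAt_dz (hdu x)).mul (hasDerivAt_dz (hdv x)))).deriv.trans ?_
    rw [hGz]
    ring
  have h₁ : G (w₀, z) = G (w, z) :=
    apply_eq_of_dw_eq_zero hG (fun w' => by simp [hGw, hv.on_line_z]) _ _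
  have h₂ : G (w₀, z₀) = G (w₀, z) :=
    apply_eq_of_dz_eq_zero hG (fun z' => by simp [hGz, hu.on_line_w]) _ _
  have h₃ : G (w₀, z₀) + u (w₀, z₀) * v (w₀, z₀) = G (w, z₀) + u (w, z₀) * v (w, z₀) :=
    apply_eq_of_dw_eq_zero hGuv (fun w' => by simp [hdw, hu.on_line_z]) _ _
  have h₄ : G (w, z₀) + u (w, z₀) * v (w, z₀) = G (w, z) + u (w, z) * v (w, z) :=
    apply_eq_of_dz_eq_zero hGuv (fun z' => by simp [hdz, hv.on_line_w]) _ _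
  rw [hu.at_pole] at h₃
  rw [hv.at_pole] at h₄
  linarith

lemma dw_comp_add_mul_swap {c D : ℝ → ℝ} (hD : ∀ ξ, HasDerivAt D (c ξ * D ξ) ξ)
    (hu : Differentiable ℝ u) : (dw fun x => D (x.1 + x.2) * u (x.2, x.1)) =
      fun x => D (x.1 + x.2) * (c (x.1 + x.2) * u (x.2, x.1) + dz u (x.2, x.1)) := by
  ext x
  refine (dw_comp_add_mul (G := fun x => u (x.2, x.1)) (hD _) (by fun_prop)).trans ?_
  rw [mul_add, mul_left_comm, mul_assoc]
  rfl

lemma dz_comp_add_mul_swap {c D : ℝ → ℝ} (hD : ∀ ξ, HasDerivAt D (c ξ * D ξ) ξ)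
    (hu : Differentiable ℝ u) : (dz fun x => D (x.1 + x.2) * u (x.2, x.1)) =
      fun x => D (x.1 + x.2) * (c (x.1 + x.2) * u (x.2, x.1) + dw u (x.2, x.1)) := by
  ext x
  refine (dz_comp_add_mul (G := fun x => u (x.2, x.1)) (hD _) (by fun_prop)).trans ?_
  rw [mul_add, mul_left_comm, mul_assoc]
  rfl

/-- Since `a` and `b` depend on `w + z` only, the reflection `(w, z) ↦ (z, w)` followed by
multiplication by a solution of `D' = (a + b) D` intertwines the equation and its adjoint. -/
lemma IsGoursatSolution.isAdjointGoursatSolution (ha : Differentiable ℝ a)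
    (hb : Differentiable ℝ b) (hu : IsGoursatSolution a b z₀ w₀ u) {D : ℝ → ℝ}
    (hD : ContDiff ℝ 2 D) (hD' : ∀ ξ, HasDerivAt D ((a ξ + b ξ) * D ξ) ξ) (hD₁ : D (w₀ + z₀) = 1) :
    IsAdjointGoursatSolution a b w₀ z₀ fun x => D (x.1 + x.2) * u (x.2, x.1) := by
  have hdu := hu.differentiable
  have hduz := hu.differentiable_dz
  have hdD : Differentiable ℝ D := fun ξ => (hD' ξ).differentiableAt
  have hus : Differentiable ℝ fun x : ℝ × ℝ => u (x.2, x.1) := by fun_prop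
  have hv : Differentiable ℝ fun x : ℝ × ℝ => D (x.1 + x.2) * u (x.2, x.1) := by fun_prop
  refine ⟨(hD.comp (by fun_prop)).mul (hu.contDiff.comp (by fun_prop)), fun x => ?_, fun w => ?_,
    fun z => ?_, by simp [hD₁, hu.at_pole]⟩
  · have hz : dz (fun x => (a (x.1 + x.2) + b (x.1 + x.2)) * u (x.2, x.1) + dz u (x.2, x.1)) x =
        (deriv a (x.1 + x.2) + deriv b (x.1 + x.2)) * u (x.2, x.1) +
          (a (x.1 + x.2) + b (x.1 + x.2)) * dw u (x.2, x.1) + dw (dz u) (x.2, x.1) :=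
      (((((ha _).hasDerivAt.add (hb _).hasDerivAt).comp_const_add x.1 x.2).mul
        (hasDerivAt_dz (hus x))).add (hasDerivAt_dw (hduz (x.2, x.1)))).deriv
    rw [dw_comp_add_mul (hb _).hasDerivAt (hv x), dz_comp_add_mul (ha _).hasDerivAt (hv x),
      dw_comp_add_mul_swap hD' hdu, dz_comp_add_mul_swap hD' hdu,
      dz_comp_add_mul (hD' _) (by fun_prop), hz]
    have heq := hu.eq (x.2, x.1)
    rw [dz_dw_comm hu.contDiff, add_comm x.2] at heq
    linear_combination D (x.1 + x.2) * heq
  · simp only [dw_comp_add_mul_swap hD' hdu, hu.on_line_w, add_comm z₀ w]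
    ring
  · simp only [dz_comp_add_mul_swap hD' hdu, hu.on_line_z, add_comm z w₀]
    ring

/-- `F` is the flux of `u` with `F_w = l₂ u_w` and `F_z = l₁ u_z` that vanishes at the pole. -/
structure IsFlux (l₁ l₂ : ℝ → ℝ) (w₀ z₀ : ℝ) (u F : ℝ × ℝ → ℝ) : Prop where
  differentiable : Differentiable ℝ F
  dw_eq : ∀ x, dw F x = l₂ (x.1 + x.2) * dw u x
  dz_eq : ∀ x, dz F x = l₁ (x.1 + x.2) * dz u x
  at_pole : F (w₀, z₀) = 0

section Flux

variable {l₁ l₂ : ℝ → ℝ} {F : ℝ × ℝ → ℝ}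

lemma IsGoursatSolution.exists_isFlux (hu : IsGoursatSolution a b w₀ z₀ u)
    (hl₁ : ∀ ξ, HasDerivAt l₁ (-a ξ * (l₂ ξ - l₁ ξ)) ξ)
    (hl₂ : ∀ ξ, HasDerivAt l₂ (b ξ * (l₂ ξ - l₁ ξ)) ξ) : ∃ F, IsFlux l₁ l₂ w₀ z₀ u F := by
  have hduw := hu.differentiable_dw
  have hduz := hu.differentiable_dz
  have hdl₁ : Differentiable ℝ l₁ := fun ξ => (hl₁ ξ).differentiableAt
  have hdl₂ : Differentiable ℝ l₂ := fun ξ => (hl₂ ξ).differentiableAt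
  have hclosed (x : ℝ × ℝ) : dz (fun y => l₂ (y.1 + y.2) * dw u y) x =
      dw (fun y => l₁ (y.1 + y.2) * dz u y) x := by
    rw [dz_comp_add_mul (hl₂ _) (hduw x), dw_comp_add_mul (hl₁ _) (hduz x),
      ← dz_dw_comm hu.contDiff]
    linear_combination (l₂ (x.1 + x.2) - l₁ (x.1 + x.2)) * hu.eq x
  obtain ⟨F, hF, hFw, hFz⟩ := exists_dw_eq_dz_eq (by fun_prop) (by fun_prop) hclosed
  refine ⟨fun x => F x - F (w₀, z₀), hF.sub_const _, fun x => ?_, fun x => ?_, sub_self _⟩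
  · exact ((hasDerivAt_dw (hF x)).sub_const _).deriv.trans (congrFun hFw x)
  · exact ((hasDerivAt_dz (hF x)).sub_const _).deriv.trans (congrFun hFz x)

lemma IsFlux.contDiff (hF : IsFlux l₁ l₂ w₀ z₀ u F) (hu : ContDiff ℝ ∞ u) (hl₁ : ContDiff ℝ ∞ l₁)
    (hl₂ : ContDiff ℝ ∞ l₂) : ContDiff ℝ ∞ F := by
  refine contDiff_infty_of_dw_dz hF.differentiable ?_ ?_
  · rw [funext hF.dw_eq]
    exact (hl₂.comp (by fun_prop)).mul (contDiff_dw (n := ∞) hu)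
  · rw [funext hF.dz_eq]
    exact (hl₁.comp (by fun_prop)).mul (contDiff_dz (n := ∞) hu)

lemma IsFlux.apply_fst (hF : IsFlux l₁ l₂ w₀ z₀ u F) (hu : IsGoursatSolution a b w₀ z₀ u)
    (hl₁ : ∀ ξ, HasDerivAt l₁ (-a ξ * (l₂ ξ - l₁ ξ)) ξ) (w : ℝ) :
    F (w, z₀) = l₁ (w + z₀) * u (w, z₀) - l₁ (w₀ + z₀) := by
  refine congrFun (eq_of_hasDerivAt_eq (f := fun w => F (w, z₀))
    (g := fun w => l₁ (w + z₀) * u (w, z₀) - l₁ (w₀ + z₀)) (t₀ := w₀)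
    (fun w => hasDerivAt_dw (hF.differentiable (w, z₀))) (fun w => ?_) ?_) w
  · refine ((((hl₁ _).comp_add_const w z₀).mul
      (hasDerivAt_dw (hu.differentiable (w, z₀)))).sub_const _).congr_deriv ?_
    rw [hF.dw_eq, hu.on_line_z]
    ring
  · simp [hF.at_pole, hu.at_pole]

lemma IsFlux.apply_snd (hF : IsFlux l₁ l₂ w₀ z₀ u F) (hu : IsGoursatSolution a b w₀ z₀ u)
    (hl₂ : ∀ ξ, HasDerivAt l₂ (b ξ * (l₂ ξ - l₁ ξ)) ξ) (z : ℝ) :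
    F (w₀, z) = l₂ (w₀ + z) * u (w₀, z) - l₂ (w₀ + z₀) := by
  refine congrFun (eq_of_hasDerivAt_eq (f := fun z => F (w₀, z))
    (g := fun z => l₂ (w₀ + z) * u (w₀, z) - l₂ (w₀ + z₀)) (t₀ := z₀)
    (fun z => hasDerivAt_dz (hF.differentiable (w₀, z))) (fun z => ?_) ?_) z
  · refine ((((hl₂ _).comp_const_add w₀ z).mul
      (hasDerivAt_dz (hu.differentiable (w₀, z)))).sub_const _).congr_deriv ?_
    rw [hF.dz_eq, hu.on_line_w]
    ring
  · simp [hF.at_pole, hu.at_pole]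

end Flux

end Goursat

/-! ### The coefficients and the characteristic speeds -/

/-- The denominator of the slow characteristic speed, as a function of `w + z`. -/
noncomputable def slowDenom (ε ξ : ℝ) : ℝ := 1 + ε + (1 - ε) * Real.exp (ε * ξ)

/-- The denominator of the fast characteristic speed, as a function of `w + z`. -/
noncomputable def fastDenom (ε ξ : ℝ) : ℝ := 1 - ε + (1 + ε) * Real.exp (ε * ξ)

section Coefficients

variable {ε : ℝ}

lemma lam1_eq (ε w z : ℝ) : lam1 ε w z = lam1 ε 0 (w + z) := by simp only [lam1, zero_add]

lemma lam2_eq (ε w z : ℝ) : lam2 ε w z = lam2 ε 0 (w + z) := by simp only [lam2, zero_add]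

lemma contDiff_slowDenom : ContDiff ℝ ∞ (slowDenom ε) := by unfold slowDenom; fun_prop

lemma contDiff_fastDenom : ContDiff ℝ ∞ (fastDenom ε) := by unfold fastDenom; fun_prop

lemma hasDerivAt_exp_mul (ε ξ : ℝ) :
    HasDerivAt (fun ξ => Real.exp (ε * ξ)) (ε * Real.exp (ε * ξ)) ξ := by
  simpa [mul_comm] using ((hasDerivAt_id ξ).const_mul ε).exp

lemma hasDerivAt_slowDenom (ε ξ : ℝ) : HasDerivAt (slowDenom ε)
    ((1 - ε ^ 2) / 4 * fastDenom ε ξ - (1 - ε) ^ 2 / 4 * slowDenom ε ξ) ξ := by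
  refine (((hasDerivAt_exp_mul ε ξ).const_mul (1 - ε)).const_add (1 + ε)).congr_deriv ?_
  rw [slowDenom, fastDenom]
  ring

lemma hasDerivAt_fastDenom (ε ξ : ℝ) : HasDerivAt (fastDenom ε)
    ((1 + ε) ^ 2 / 4 * fastDenom ε ξ - (1 - ε ^ 2) / 4 * slowDenom ε ξ) ξ := by
  refine (((hasDerivAt_exp_mul ε ξ).const_mul (1 + ε)).const_add (1 - ε)).congr_deriv ?_
  rw [slowDenom, fastDenom]
  ring

lemma aBar_eq (ε ξ : ℝ) : aBar ε ξ = -((1 - ε ^ 2) / 4) * (fastDenom ε ξ / slowDenom ε ξ) := rfl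

lemma bBar_eq (ε ξ : ℝ) : bBar ε ξ = (1 - ε ^ 2) / 4 * (slowDenom ε ξ / fastDenom ε ξ) := rfl

variable (h0 : 0 < ε) (h1 : ε < 1)
include h0 h1

lemma slowDenom_pos (ξ : ℝ) : 0 < slowDenom ε ξ := by
  have := mul_pos (sub_pos.2 h1) (Real.exp_pos (ε * ξ))
  unfold slowDenom
  positivity

lemma fastDenom_pos (ξ : ℝ) : 0 < fastDenom ε ξ := by
  have := sub_pos.2 h1
  unfold fastDenom
  positivity

lemma differentiable_aBar : Differentiable ℝ (aBar ε) := fun ξ =>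
  (((hasDerivAt_fastDenom ε ξ).div (hasDerivAt_slowDenom ε ξ)
    (slowDenom_pos h0 h1 ξ).ne').const_mul _).differentiableAt

lemma differentiable_bBar : Differentiable ℝ (bBar ε) := fun ξ =>
  (((hasDerivAt_slowDenom ε ξ).div (hasDerivAt_fastDenom ε ξ)
    (fastDenom_pos h0 h1 ξ).ne').const_mul _).differentiableAt

lemma contDiff_lam1 : ContDiff ℝ ∞ fun x : ℝ × ℝ => lam1 ε x.1 x.2 := by
  unfold lam1
  exact contDiff_const.mul (ContDiff.div (by fun_prop) (by fun_prop)
    fun x => (slowDenom_pos h0 h1 (x.1 + x.2)).ne')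

lemma contDiff_lam2 : ContDiff ℝ ∞ fun x : ℝ × ℝ => lam2 ε x.1 x.2 := by
  unfold lam2
  exact contDiff_const.mul (ContDiff.div (by fun_prop) (by fun_prop)
    fun x => (fastDenom_pos h0 h1 (x.1 + x.2)).ne')

lemma lam1_eq_div (ξ : ℝ) : lam1 ε 0 ξ = 1 / ε - 2 * (1 + ε) / ε / slowDenom ε ξ := by
  have := (slowDenom_pos h0 h1 ξ).ne'
  rw [lam1, zero_add, show 1 + ε - (1 - ε) * Real.exp (ε * ξ) = 2 * (1 + ε) - slowDenom ε ξ by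
    rw [slowDenom]; ring, ← slowDenom]
  field_simp
  ring

lemma lam2_eq_div (ξ : ℝ) : lam2 ε 0 ξ = 1 / ε - 2 * (1 - ε) / ε / fastDenom ε ξ := by
  have := (fastDenom_pos h0 h1 ξ).ne'
  rw [lam2, zero_add, show 1 - ε - (1 + ε) * Real.exp (ε * ξ) = 2 * (1 - ε) - fastDenom ε ξ by
    rw [fastDenom]; ring, ← fastDenom]
  field_simp
  ring

lemma lam2_sub_lam1 (ξ : ℝ) :
    lam2 ε 0 ξ - lam1 ε 0 ξ = 8 * Real.exp (ε * ξ) / (slowDenom ε ξ * fastDenom ε ξ) := by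
  have hA := (slowDenom_pos h0 h1 ξ).ne'
  have hB := (fastDenom_pos h0 h1 ξ).ne'
  rw [lam1_eq_div h0 h1, lam2_eq_div h0 h1]
  field_simp
  rw [slowDenom, fastDenom]
  ring

lemma lam1_lt_lam2 (ξ : ℝ) : lam1 ε 0 ξ < lam2 ε 0 ξ := by
  have := slowDenom_pos h0 h1 ξ
  have := fastDenom_pos h0 h1 ξ
  rw [← sub_pos, lam2_sub_lam1 h0 h1]
  positivity

lemma hasDerivAt_lam1 (ξ : ℝ) :
    HasDerivAt (lam1 ε 0) (-aBar ε ξ * (lam2 ε 0 ξ - lam1 ε 0 ξ)) ξ := by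
  have hA := (slowDenom_pos h0 h1 ξ).ne'
  have hB := (fastDenom_pos h0 h1 ξ).ne'
  rw [lam2_sub_lam1 h0 h1, funext (lam1_eq_div h0 h1)]
  refine (((hasDerivAt_const ξ (2 * (1 + ε) / ε)).div (hasDerivAt_slowDenom ε ξ) hA).const_sub
    (1 / ε)).congr_deriv ?_
  rw [aBar_eq]
  field_simp
  rw [slowDenom, fastDenom]
  ring

lemma hasDerivAt_lam2 (ξ : ℝ) :
    HasDerivAt (lam2 ε 0) (bBar ε ξ * (lam2 ε 0 ξ - lam1 ε 0 ξ)) ξ := by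
  have hA := (slowDenom_pos h0 h1 ξ).ne'
  have hB := (fastDenom_pos h0 h1 ξ).ne'
  rw [lam2_sub_lam1 h0 h1, funext (lam2_eq_div h0 h1)]
  refine (((hasDerivAt_const ξ (2 * (1 - ε) / ε)).div (hasDerivAt_fastDenom ε ξ) hB).const_sub
    (1 / ε)).congr_deriv ?_
  rw [bBar_eq]
  field_simp
  rw [slowDenom, fastDenom]
  ring

end Coefficients

/-! ### Solving the Goursat problem -/

/-- The telegraph system with constant data on a pair of characteristics is solved by Bessel
functions of `2 κ √((w - w₀) (z - z₀))`. -/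
lemma exists_telegraph_system (κ w₀ z₀ m₁ m₂ : ℝ) : ∃ P Q : ℝ × ℝ → ℝ,
    ContDiff ℝ ∞ P ∧ ContDiff ℝ ∞ Q ∧
    (∀ w z, HasDerivAt (fun z => P (w, z)) (κ * Q (w, z)) z) ∧
    (∀ w z, HasDerivAt (fun w => Q (w, z)) (-κ * P (w, z)) w) ∧
    (∀ w, P (w, z₀) = κ * m₁) ∧ ∀ z, Q (w₀, z) = -κ * m₂ := by
  have hJ (k : ℕ) := contDiff_besselSeries k
  let t (x : ℝ × ℝ) : ℝ := -κ ^ 2 * (x.1 - w₀) * (x.2 - z₀)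
  have ht : ContDiff ℝ ∞ t := by fun_prop
  have htw (w z : ℝ) : HasDerivAt (fun w => t (w, z)) (-κ ^ 2 * (z - z₀)) w :=
    ((((hasDerivAt_id w).sub_const w₀).const_mul (-κ ^ 2)).mul_const (z - z₀)).congr_deriv (by ring)
  have htz (w z : ℝ) : HasDerivAt (fun z => t (w, z)) (-κ ^ 2 * (w - w₀)) z :=
    (((hasDerivAt_id z).sub_const z₀).const_mul (-κ ^ 2 * (w - w₀))).congr_deriv (by ring)
  have hJw (k : ℕ) (w z : ℝ) := (hasDerivAt_besselSeries k (t (w, z))).comp w (htw w z)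
  have hJz (k : ℕ) (w z : ℝ) := (hasDerivAt_besselSeries k (t (w, z))).comp z (htz w z)
  refine ⟨fun x => κ * (m₁ * besselSeries 0 (t x) - m₂ * κ * ((x.2 - z₀) * besselSeries 1 (t x))),
    fun x => -κ * (m₂ * besselSeries 0 (t x) + m₁ * κ * ((x.1 - w₀) * besselSeries 1 (t x))),
    by fun_prop, by fun_prop, fun w z => ?_, fun w z => ?_, fun w => ?_, fun z => ?_⟩
  · refine ((((hJz 0 w z).const_mul m₁).sub
      ((((hasDerivAt_id z).sub_const z₀).mul (hJz 1 w z)).const_mul (m₂ * κ))).const_mul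
        κ).congr_deriv ?_
    simp only [Function.comp_apply, id_eq, zero_add, Nat.reduceAdd]
    linear_combination -κ ^ 2 * m₂ * besselSeries_recurrence (t (w, z))
  · refine ((((hJw 0 w z).const_mul m₂).add
      ((((hasDerivAt_id w).sub_const w₀).mul (hJw 1 w z)).const_mul (m₁ * κ))).const_mul
        (-κ)).congr_deriv ?_
    simp only [Function.comp_apply, id_eq, zero_add, Nat.reduceAdd]
    linear_combination -κ ^ 2 * m₁ * besselSeries_recurrence (t (w, z))
  · simp [t, besselSeries_zero_apply_zero]
  · simp [t, besselSeries_zero_apply_zero]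

/-- The values of the solution of the Goursat problem on the characteristic `z = z₀`. -/
noncomputable def goursatDataFst (ε w₀ z₀ w : ℝ) : ℝ :=
  Real.exp ((1 - ε) ^ 2 / 4 * (w - w₀)) * slowDenom ε (w + z₀) / slowDenom ε (w₀ + z₀)

/-- The values of the solution of the Goursat problem on the characteristic `w = w₀`. -/
noncomputable def goursatDataSnd (ε w₀ z₀ z : ℝ) : ℝ :=
  Real.exp (-((1 + ε) ^ 2 / 4 * (z - z₀))) * fastDenom ε (w₀ + z) / fastDenom ε (w₀ + z₀)

section Existence

variable {ε : ℝ} (h0 : 0 < ε) (h1 : ε < 1) (w₀ z₀ : ℝ)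
include h0 h1

lemma hasDerivAt_goursatDataFst (w : ℝ) : HasDerivAt (goursatDataFst ε w₀ z₀)
    (-aBar ε (w + z₀) * goursatDataFst ε w₀ z₀ w) w := by
  have hA := (slowDenom_pos h0 h1 (w + z₀)).ne'
  have hexp := (((hasDerivAt_id w).sub_const w₀).const_mul ((1 - ε) ^ 2 / 4)).exp
  refine ((hexp.mul ((hasDerivAt_slowDenom ε (w + z₀)).comp_add_const w z₀)).div_const
    _).congr_deriv ?_
  rw [goursatDataFst, aBar_eq]
  simp only [id_eq]
  field_simp
  ring

lemma hasDerivAt_goursatDataSnd (z : ℝ) : HasDerivAt (goursatDataSnd ε w₀ z₀)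
    (-bBar ε (w₀ + z) * goursatDataSnd ε w₀ z₀ z) z := by
  have hB := (fastDenom_pos h0 h1 (w₀ + z)).ne'
  have hexp := (((hasDerivAt_id z).sub_const z₀).const_mul ((1 + ε) ^ 2 / 4)).neg.exp
  refine ((hexp.mul ((hasDerivAt_fastDenom ε (w₀ + z)).comp_const_add w₀ z)).div_const
    _).congr_deriv ?_
  rw [goursatDataSnd, bBar_eq]
  simp only [id_eq, Pi.neg_apply]
  field_simp
  ring

lemma goursatDataFst_self : goursatDataFst ε w₀ z₀ w₀ = 1 := by
  simp [goursatDataFst, (slowDenom_pos h0 h1 _).ne']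

lemma goursatDataSnd_self : goursatDataSnd ε w₀ z₀ z₀ = 1 := by
  simp [goursatDataSnd, (fastDenom_pos h0 h1 _).ne']

/-- The weights `slowDenom` and `fastDenom` and an exponential reduce the system satisfied by the
gradient of a solution to the telegraph system. -/
lemma exists_gradient_system : ∃ p q : ℝ × ℝ → ℝ, ContDiff ℝ ∞ p ∧ ContDiff ℝ ∞ q ∧
    (∀ x, dz p x = -(bBar ε (x.1 + x.2) * p x + aBar ε (x.1 + x.2) * q x)) ∧
    (∀ x, dw q x = -(bBar ε (x.1 + x.2) * p x + aBar ε (x.1 + x.2) * q x)) ∧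
    (∀ w, p (w, z₀) = -aBar ε (w + z₀) * goursatDataFst ε w₀ z₀ w) ∧
    ∀ z, q (w₀, z) = -bBar ε (w₀ + z) * goursatDataSnd ε w₀ z₀ z := by
  obtain ⟨P, Q, hP, hQ, hPz, hQw, hP₀, hQ₀⟩ := exists_telegraph_system ((1 - ε ^ 2) / 4) w₀ z₀
    (slowDenom ε (w₀ + z₀))⁻¹ (fastDenom ε (w₀ + z₀))⁻¹
  have hcA := contDiff_slowDenom (ε := ε)
  have hcB := contDiff_fastDenom (ε := ε)
  have hA (ξ : ℝ) := (slowDenom_pos h0 h1 ξ).ne'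
  have hB (ξ : ℝ) := (fastDenom_pos h0 h1 ξ).ne'
  let e (x : ℝ × ℝ) : ℝ :=
    Real.exp ((1 - ε) ^ 2 / 4 * (x.1 - w₀) - (1 + ε) ^ 2 / 4 * (x.2 - z₀))
  have hez (x : ℝ × ℝ) :=
    (((hasDerivAt_id x.2).sub_const z₀).const_mul ((1 + ε) ^ 2 / 4)).const_sub
      ((1 - ε) ^ 2 / 4 * (x.1 - w₀)) |>.exp
  have hew (x : ℝ × ℝ) :=
    (((hasDerivAt_id x.1).sub_const w₀).const_mul ((1 - ε) ^ 2 / 4)).sub_const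
      ((1 + ε) ^ 2 / 4 * (x.2 - z₀)) |>.exp
  refine ⟨fun x => e x * fastDenom ε (x.1 + x.2) * P x,
    fun x => e x * slowDenom ε (x.1 + x.2) * Q x,
    by fun_prop, by fun_prop, fun x => ?_, fun x => ?_, fun w => ?_, fun z => ?_⟩
  · refine (((hez x).mul ((hasDerivAt_fastDenom ε (x.1 + x.2)).comp_const_add x.1 x.2)).mul
      (hPz x.1 x.2)).deriv.trans ?_
    rw [aBar_eq, bBar_eq]
    simp only [e, id_eq, Pi.mul_apply]
    field_simp [hA, hB]
    ring
  · refine (((hew x).mul ((hasDerivAt_slowDenom ε (x.1 + x.2)).comp_add_const x.1 x.2)).mul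
      (hQw x.1 x.2)).deriv.trans ?_
    rw [aBar_eq, bBar_eq]
    simp only [e, id_eq, Pi.mul_apply]
    field_simp [hA, hB]
    ring
  · simp only [hP₀, aBar_eq, goursatDataFst, e, sub_self, mul_zero, sub_zero]
    field_simp [hA]
  · simp only [hQ₀, bBar_eq, goursatDataSnd, e, sub_self, mul_zero, zero_sub]
    field_simp [hB]

theorem exists_isGoursatSolution : ∃ u, ContDiff ℝ ∞ u ∧
    IsGoursatSolution (aBar ε) (bBar ε) w₀ z₀ u := by
  obtain ⟨p, q, hp, hq, hpz, hqw, hp₀, hq₀⟩ := exists_gradient_system h0 h1 w₀ z₀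
  obtain ⟨G, hG, hGw, hGz⟩ := exists_dw_eq_dz_eq (hp.differentiable (by simp))
    (hq.differentiable (by simp)) fun x => (hpz x).trans (hqw x).symm
  let u (x : ℝ × ℝ) : ℝ := G x - G (w₀, z₀) + 1
  have hu : Differentiable ℝ u := by fun_prop
  have huw : dw u = p := hGw ▸ funext fun x =>
    (((hasDerivAt_dw (hG x)).sub_const (G (w₀, z₀))).add_const 1).deriv
  have huz : dz u = q := hGz ▸ funext fun x =>
    (((hasDerivAt_dz (hG x)).sub_const (G (w₀, z₀))).add_const 1).deriv
  have hu₀ : u (w₀, z₀) = 1 := by simp [u]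
  have hcu : ContDiff ℝ ∞ u := contDiff_infty_of_dw_dz hu (huw ▸ hp) (huz ▸ hq)
  have hline_z : (fun w => u (w, z₀)) = goursatDataFst ε w₀ z₀ :=
    eq_of_hasDerivAt_eq (fun w => hasDerivAt_dw (hu (w, z₀)))
      (fun w => by rw [huw, hp₀]; exact hasDerivAt_goursatDataFst h0 h1 w₀ z₀ w)
      (hu₀.trans (goursatDataFst_self h0 h1 w₀ z₀).symm)
  have hline_w : (fun z => u (w₀, z)) = goursatDataSnd ε w₀ z₀ :=
    eq_of_hasDerivAt_eq (fun z => hasDerivAt_dz (hu (w₀, z)))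
      (fun z => by rw [huz, hq₀]; exact hasDerivAt_goursatDataSnd h0 h1 w₀ z₀ z)
      (hu₀.trans (goursatDataSnd_self h0 h1 w₀ z₀).symm)
  refine ⟨u, hcu, contDiff_infty.1 hcu 2, fun x => ?_, fun w => ?_, fun z => ?_, hu₀⟩
  · rw [huw, huz, hpz]
    ring
  · rw [huw, hp₀, ← hline_z]
  · rw [huz, hq₀, ← hline_w]

lemma IsRiemannFunction.apply_eq {R : ℝ → ℝ → ℝ → ℝ → ℝ} (hR : IsRiemannFunction ε R) {x y : ℝ}
    {u : ℝ × ℝ → ℝ} (hu : IsGoursatSolution (aBar ε) (bBar ε) x y u) (w z : ℝ) :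
    R x y w z = u (w, z) :=
  (isRiemannFunction_iff.1 hR w z).apply_eq_apply (differentiable_aBar h0 h1)
    (differentiable_bBar h0 h1) hu

theorem exists_isRiemannFunction : ∃ R, IsRiemannFunction ε R := by
  choose u _ hu using exists_isGoursatSolution h0 h1
  let gap (ξ : ℝ) : ℝ := lam2 ε 0 ξ - lam1 ε 0 ξ
  have hgap (ξ : ℝ) : HasDerivAt gap ((aBar ε ξ + bBar ε ξ) * gap ξ) ξ :=
    ((hasDerivAt_lam2 h0 h1 ξ).sub (hasDerivAt_lam1 h0 h1 ξ)).congr_deriv (by ring)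
  have hgap₀ (ξ : ℝ) : gap ξ ≠ 0 := (sub_pos.2 (lam1_lt_lam2 h0 h1 ξ)).ne'
  have hcgap : ContDiff ℝ 2 gap :=
    contDiff_infty.1 (((contDiff_lam2 h0 h1).sub (contDiff_lam1 h0 h1)).comp
      (contDiff_prodMk_right 0)) 2
  refine ⟨fun x y w z => gap (x + y) / gap (w + z) * u z w (y, x),
    isRiemannFunction_iff.2 fun w z => ?_⟩
  exact (hu z w).isAdjointGoursatSolution (D := fun ξ => gap ξ / gap (w + z))
    (differentiable_aBar h0 h1) (differentiable_bBar h0 h1) (hcgap.div_const _)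
    (fun ξ => ((hgap ξ).div_const _).congr_deriv (mul_div_assoc _ _ _)) (div_self (hgap₀ _))

theorem existsUnique_isRiemannFunction : ∃! R, IsRiemannFunction ε R := by
  obtain ⟨R, hR⟩ := exists_isRiemannFunction h0 h1
  refine ⟨R, hR, fun R' hR' => ?_⟩
  ext x y w z
  obtain ⟨u, -, hu⟩ := exists_isGoursatSolution h0 h1 x y
  rw [hR.apply_eq h0 h1 hu, hR'.apply_eq h0 h1 hu]

variable {w₀ z₀} {u : ℝ × ℝ → ℝ}

lemma IsGoursatSolution.apply_fst (hu : IsGoursatSolution (aBar ε) (bBar ε) w₀ z₀ u) (w : ℝ) :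
    u (w, z₀) = goursatDataFst ε w₀ z₀ w := by
  refine congrFun (eq_of_hasDerivAt_mul (f := fun w => u (w, z₀))
    (c := fun w => -aBar ε (w + z₀)) (t₀ := w₀)
    (fun w => hu.on_line_z w ▸ hasDerivAt_dw (hu.differentiable (w, z₀)))
    (hasDerivAt_goursatDataFst h0 h1 w₀ z₀) (fun w => ?_) ?_) w
  · have hA (ξ : ℝ) := slowDenom_pos h0 h1 ξ
    exact (div_pos (mul_pos (Real.exp_pos _) (hA _)) (hA _)).ne'
  · rw [hu.at_pole, goursatDataFst_self h0 h1]

lemma IsGoursatSolution.apply_snd (hu : IsGoursatSolution (aBar ε) (bBar ε) w₀ z₀ u) (z : ℝ) :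
    u (w₀, z) = goursatDataSnd ε w₀ z₀ z := by
  refine congrFun (eq_of_hasDerivAt_mul (f := fun z => u (w₀, z))
    (c := fun z => -bBar ε (w₀ + z)) (t₀ := z₀)
    (fun z => hu.on_line_w z ▸ hasDerivAt_dz (hu.differentiable (w₀, z)))
    (hasDerivAt_goursatDataSnd h0 h1 w₀ z₀) (fun z => ?_) ?_) z
  · have hB (ξ : ℝ) := fastDenom_pos h0 h1 ξ
    exact (div_pos (mul_pos (Real.exp_pos _) (hB _)) (hB _)).ne'
  · rw [hu.at_pole, goursatDataSnd_self h0 h1]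

end Existence

/-! ### Integration by parts across the axes and the diagonal -/

lemma integral_ite_lt_mul_deriv {f : ℝ → ℝ} (hf : ContDiff ℝ 1 f) (hc : HasCompactSupport f)
    (α β c : ℝ) : ∫ t, (if t < c then α else β) * deriv f t = (α - β) * f c := by
  have hint : Integrable (deriv f) :=
    (hf.continuous_deriv le_rfl).integrable_of_hasCompactSupport hc.deriv
  have hsplit (t : ℝ) : (if t < c then α else β) * deriv f t =
      (α - β) * (Set.Iio c).indicator (deriv f) t + β * deriv f t := by
    by_cases ht : t < c
    · simp only [ht, if_true, Set.indicator_of_mem (Set.mem_Iio.2 ht)]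
      ring
    · simp [ht]
  simp only [hsplit]
  rw [integral_add ((hint.indicator measurableSet_Iio).const_mul _) (hint.const_mul _),
    integral_const_mul, integral_const_mul, integral_indicator measurableSet_Iio,
    ← integral_Iic_eq_integral_Iio, hc.integral_Iic_deriv_eq hf,
    integral_eq_zero_of_hasDerivAt_of_integrable
      (fun t => (hf.differentiable one_ne_zero t).hasDerivAt) hint
      (hf.continuous.integrable_of_hasCompactSupport hc), mul_zero, add_zero]

section IntegrationByParts

variable {G φ : ℝ × ℝ → ℝ}

lemma continuous_dw (hφ : ContDiff ℝ 1 φ) : Continuous (dw φ) :=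
  (contDiff_dw (n := 0) hφ).continuous

lemma hasCompactSupport_dw (hφ : Differentiable ℝ φ) (hc : HasCompactSupport φ) :
    HasCompactSupport (dw φ) := by
  rw [dw_eq_fderiv hφ]
  exact hc.fderiv_apply ℝ (1, 0)

lemma integrable_dw (hφ : ContDiff ℝ 1 φ) (hc : HasCompactSupport φ) : Integrable (dw φ) :=
  (continuous_dw hφ).integrable_of_hasCompactSupport
    (hasCompactSupport_dw (hφ.differentiable one_ne_zero) hc)

lemma dw_mul (hG : Differentiable ℝ G) (hφ : Differentiable ℝ φ) (x : ℝ × ℝ) :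
    dw (fun y => G y * φ y) x = dw G x * φ x + G x * dw φ x :=
  ((hasDerivAt_dw (hG x)).mul (hasDerivAt_dw (hφ x))).deriv

lemma integral_ite_lt_mul_dw (hφ : ContDiff ℝ 1 φ) (hc : HasCompactSupport φ) {α β c : ℝ → ℝ}
    (hα : Measurable α) (hβ : Measurable β) (hm : Measurable c) {C : ℝ} (hαC : ∀ z, |α z| ≤ C)
    (hβC : ∀ z, |β z| ≤ C) :
    ∫ x : ℝ × ℝ, (if x.1 < c x.2 then α x.2 else β x.2) * dw φ x =
      ∫ z, (α z - β z) * φ (c z, z) := by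
  have hmeas : Measurable fun x : ℝ × ℝ => if x.1 < c x.2 then α x.2 else β x.2 :=
    Measurable.ite (measurableSet_lt (by fun_prop) (by fun_prop)) (by fun_prop) (by fun_prop)
  have hint : Integrable fun x : ℝ × ℝ => (if x.1 < c x.2 then α x.2 else β x.2) * dw φ x :=
    (integrable_dw hφ hc).bdd_mul hmeas.aestronglyMeasurable (c := C) <| .of_forall fun x => by
      split_ifs
      exacts [hαC x.2, hβC x.2]
  rw [Measure.volume_eq_prod] at hint ⊢
  rw [integral_prod_symm _ hint]
  congr! 2 with z
  have hslice : Topology.IsClosedEmbedding fun w : ℝ => (w, z) :=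
    Isometry.isClosedEmbedding (.of_dist_eq fun w w' => by simp [Prod.dist_eq])
  exact integral_ite_lt_mul_deriv (f := fun w => φ (w, z)) (by fun_prop)
    (hc.comp_isClosedEmbedding hslice) (α z) (β z) (c z)

lemma measurable_sign : Measurable Real.sign :=
  Measurable.ite measurableSet_Iio measurable_const
    (Measurable.ite measurableSet_Ioi measurable_const measurable_const)

lemma abs_sign_le_one (t : ℝ) : |Real.sign t| ≤ 1 := by
  rcases Real.sign_apply_eq t with h | h | h <;> simp [h]

lemma measurableSet_mul_neg : MeasurableSet {x : ℝ × ℝ | x.1 * x.2 < 0} :=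
  measurableSet_lt (by fun_prop) (by fun_prop)

lemma ae_mul_ne_zero : ∀ᵐ x : ℝ × ℝ, x.1 * x.2 ≠ 0 := by
  rw [Measure.volume_eq_prod]
  filter_upwards [Measure.quasiMeasurePreserving_fst.ae (Measure.ae_ne volume (0 : ℝ)),
    Measure.quasiMeasurePreserving_snd.ae (Measure.ae_ne volume (0 : ℝ))] with x hw hz
  exact mul_ne_zero hw hz

lemma ae_fst_ne_snd : ∀ᵐ x : ℝ × ℝ, x.1 ≠ x.2 := by
  rw [Measure.volume_eq_prod, Measure.ae_prod_iff_ae_ae]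
  · exact .of_forall fun w => (Measure.ae_ne volume w).mono fun z hz => hz.symm
  · exact (measurableSet_eq_fun measurable_fst measurable_snd).compl

lemma setIntegral_mul_neg_dw (hφ : ContDiff ℝ 1 φ) (hc : HasCompactSupport φ) :
    ∫ x in {x : ℝ × ℝ | x.1 * x.2 < 0}, dw φ x = ∫ z, Real.sign z * φ (0, z) := by
  have hsign := measurable_sign
  have hbound (s : ℝ) (hs : s = 1 ∨ s = -1) (z : ℝ) : |(1 + s * Real.sign z) / 2| ≤ 1 := by
    rcases hs with rfl | rfl <;> rcases Real.sign_apply_eq z with h | h | h <;> norm_num [h]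
  have key := integral_ite_lt_mul_dw hφ hc (α := fun z => (1 + 1 * Real.sign z) / 2)
    (β := fun z => (1 + -1 * Real.sign z) / 2) (by fun_prop) (by fun_prop)
    (measurable_const (a := 0)) (hbound 1 (.inl rfl)) (hbound (-1) (.inr rfl))
  rw [← integral_indicator measurableSet_mul_neg]
  refine (integral_congr_ae ?_).trans (key.trans (integral_congr_ae (.of_forall fun z => ?_)))
  · filter_upwards [ae_mul_ne_zero] with x hx
    rcases mul_ne_zero_iff.1 hx with ⟨hw, hz⟩
    rcases hw.lt_or_gt with hw | hw <;> rcases hz.lt_or_gt with hz | hz <;>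
      simp [Set.indicator, mul_neg_iff, hw, hz, hw.not_gt, hz.not_gt, Real.sign_of_neg,
        Real.sign_of_pos]
  · ring

lemma integral_sign_mul_sign_sub_mul_dw (hφ : ContDiff ℝ 1 φ) (hc : HasCompactSupport φ)
    (hdiag : ∀ z, φ (z, z) = 0) :
    ∫ x : ℝ × ℝ, Real.sign x.2 * Real.sign (x.1 - x.2) * dw φ x = 0 := by
  have key := integral_ite_lt_mul_dw hφ hc measurable_sign.neg measurable_sign measurable_id
    (fun z => (abs_neg _).trans_le (abs_sign_le_one z)) abs_sign_le_one
  simp only [id_eq, hdiag, mul_zero, integral_zero] at key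
  refine (integral_congr_ae ?_).trans key
  filter_upwards [ae_fst_ne_snd] with x hx
  rcases hx.lt_or_gt with hx | hx
  · simp [hx, Real.sign_of_neg (sub_neg.2 hx)]
  · simp [hx.not_gt, Real.sign_of_pos (sub_pos.2 hx)]

/-- The weak `w`-derivative, off the diagonal, of a function which is `G` on `w z ≤ 0` up to a
function which is constant on each component of `w ≠ z`, `w z ≠ 0` and does not jump across
`w = 0`. -/
lemma integral_piecewise_mul_dw (hG : ContDiff ℝ 1 G) (hφ : ContDiff ℝ 1 φ)
    (hc : HasCompactSupport φ) (hdiag : ∀ z, φ (z, z) = 0) {g : ℝ × ℝ → ℝ} (k : ℝ)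
    (hg : ∀ x : ℝ × ℝ, x.1 * x.2 ≠ 0 → g x = k * (Real.sign x.2 * Real.sign (x.1 - x.2)) +
      Set.indicator {x : ℝ × ℝ | x.1 * x.2 < 0} G x) :
    -∫ x, g x * dw φ x = (∫ x in {x : ℝ × ℝ | x.1 * x.2 < 0}, dw G x * φ x) -
      ∫ z, Real.sign z * (G (0, z) * φ (0, z)) := by
  have hsplit : (fun x => g x * dw φ x) =ᵐ[volume] fun x =>
      k * (Real.sign x.2 * Real.sign (x.1 - x.2) * dw φ x) +
        Set.indicator {x : ℝ × ℝ | x.1 * x.2 < 0} (fun x => G x * dw φ x) x := by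
    filter_upwards [ae_mul_ne_zero] with x hx
    rw [hg x hx, Set.indicator_mul_left]
    ring
  have hint_sign : Integrable fun x : ℝ × ℝ =>
      Real.sign x.2 * Real.sign (x.1 - x.2) * dw φ x := by
    have hmeas := measurable_sign
    refine (integrable_dw hφ hc).bdd_mul (c := 1) (by fun_prop) (.of_forall fun x => ?_)
    rw [norm_mul]
    exact mul_le_one₀ (abs_sign_le_one _) (norm_nonneg _) (abs_sign_le_one _)
  have hint_dw : Integrable fun x => dw G x * φ x :=
    ((continuous_dw hG).mul hφ.continuous).integrable_of_hasCompactSupport hc.mul_left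
  have hint : Integrable fun x => G x * dw φ x :=
    (hG.continuous.mul (continuous_dw hφ)).integrable_of_hasCompactSupport
      (hasCompactSupport_dw (hφ.differentiable one_ne_zero) hc).mul_left
  rw [integral_congr_ae hsplit,
    integral_add (hint_sign.const_mul k) (hint.indicator measurableSet_mul_neg),
    integral_const_mul, integral_sign_mul_sign_sub_mul_dw hφ hc hdiag,
    integral_indicator measurableSet_mul_neg,
    ← setIntegral_mul_neg_dw (φ := fun x => G x * φ x) (hG.mul hφ) hc.mul_left]
  simp only [dw_mul (hG.differentiable one_ne_zero) (hφ.differentiable one_ne_zero)]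
  rw [integral_add hint_dw.integrableOn hint.integrableOn]
  ring

lemma integral_swap (f : ℝ × ℝ → ℝ) : ∫ x : ℝ × ℝ, f x.swap = ∫ x, f x := by
  rw [Measure.volume_eq_prod]
  exact integral_prod_swap f

lemma setIntegral_mul_neg_swap (f : ℝ × ℝ → ℝ) :
    ∫ x in {x : ℝ × ℝ | x.1 * x.2 < 0}, f x.swap = ∫ x in {x : ℝ × ℝ | x.1 * x.2 < 0}, f x := by
  rw [← integral_indicator measurableSet_mul_neg, ← integral_indicator measurableSet_mul_neg,
    ← integral_swap]
  simp [Set.indicator, mul_comm]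

lemma integral_piecewise_mul_dz (hG : ContDiff ℝ 1 G) (hφ : ContDiff ℝ 1 φ)
    (hc : HasCompactSupport φ) (hdiag : ∀ z, φ (z, z) = 0) {g : ℝ × ℝ → ℝ} (k : ℝ)
    (hg : ∀ x : ℝ × ℝ, x.1 * x.2 ≠ 0 → g x = k * (Real.sign x.1 * Real.sign (x.2 - x.1)) +
      Set.indicator {x : ℝ × ℝ | x.1 * x.2 < 0} G x) :
    -∫ x, g x * dz φ x = (∫ x in {x : ℝ × ℝ | x.1 * x.2 < 0}, dz G x * φ x) -
      ∫ w, Real.sign w * (G (w, 0) * φ (w, 0)) := by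
  have hswap : ContDiff ℝ 1 (Prod.swap : ℝ × ℝ → ℝ × ℝ) := contDiff_snd.prodMk contDiff_fst
  rw [← integral_swap, ← setIntegral_mul_neg_swap]
  exact integral_piecewise_mul_dw (g := g ∘ Prod.swap) (hG.comp hswap) (hφ.comp hswap)
    (hc.comp_homeomorph (Homeomorph.prodComm ℝ ℝ)) hdiag k fun x hx => by
      simp [hg x.swap (by simpa [mul_comm] using hx), Set.indicator, mul_comm x.2]

end IntegrationByParts

/-! ### Functions with vanishing weak gradient on a convex cone -/

section WeakGradient

open TopologicalSpace
open scoped Distributions LineDeriv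

lemma integrable_mul_of_tsupport_subset {X : Type*} [TopologicalSpace X] [T2Space X]
    [MeasurableSpace X] [OpensMeasurableSpace X] [SecondCountableTopologyEither X ℝ]
    {μ : Measure X} {Ω : Set X} {τ ψ : X → ℝ} (hτ : LocallyIntegrableOn τ Ω μ)
    (hψ : Continuous ψ) (hc : HasCompactSupport ψ) (hs : tsupport ψ ⊆ Ω) :
    Integrable (fun x => τ x * ψ x) μ :=
  (integrableOn_iff_integrable_of_support_subset
    ((Function.support_mul_subset_right _ _).trans (subset_tsupport ψ))).1
    ((hτ.integrableOn_compact_subset hs hc).mul_continuousOn hψ.continuousOn hc)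

variable {E : Type*} [NormedAddCommGroup E] [NormedSpace ℝ E] {Ω : Opens E}

lemma lineDerivOp_apply_eq_fderiv (φ : 𝓓(Ω, ℝ)) (h x : E) : (∂_{h} φ) x = fderiv ℝ φ x h :=
  (TestFunction.lineDerivCLM_apply_of_le le_rfl).trans
    (φ.contDiff.differentiable (by simp) x).lineDeriv_eq_fderiv

/-- The test function `φ` translated by a vector `h` that maps `Ω` into itself. -/
noncomputable def translate (φ : 𝓓(Ω, ℝ)) (h : E) (hh : ∀ x ∈ Ω, x + h ∈ Ω) : 𝓓(Ω, ℝ) where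
  toFun x := φ (x - h)
  contDiff' := φ.contDiff.comp (by fun_prop)
  hasCompactSupport' := φ.hasCompactSupport.comp_homeomorph (Homeomorph.subRight h)
  tsupport_subset' x hx := by
    have hxh := tsupport_comp_subset_preimage φ (f := fun x => x - h) (by fun_prop) hx
    simpa using hh _ (φ.tsupport_subset hxh)

lemma setIntegral_neg_lineDerivOp_sub_smul (φ : 𝓓(Ω, ℝ)) (h x : E) :
    ∫ t in Set.Icc (0 : ℝ) 1, -1 * (∂_{h} φ) (x - t • h) = φ (x - h) - φ x := by
  rw [integral_Icc_eq_integral_Ioc, ← intervalIntegral.integral_of_le zero_le_one,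
    intervalIntegral.integral_eq_sub_of_hasDerivAt (f := fun t : ℝ => φ (x - t • h))]
  · simp
  · intro t _
    have hline : HasDerivAt (fun t : ℝ => x - t • h) (-h) t := by
      simpa using ((hasDerivAt_id t).smul_const h).const_sub x
    rw [lineDerivOp_apply_eq_fderiv, neg_one_mul, ← map_neg]
    exact (φ.contDiff.differentiable (by simp) _).hasFDerivAt.comp_hasDerivAt t hline
  · exact Continuous.intervalIntegrable (by fun_prop) _ _

variable [MeasurableSpace E] [BorelSpace E] {μ : Measure E} {τ : E → ℝ}

lemma integral_mul_setIntegral_comp_sub [SFinite μ] {Y : Type*} [TopologicalSpace Y] [T2Space Y]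
    [SecondCountableTopology Y] [MeasurableSpace Y] [BorelSpace Y] {ν : Measure Y}
    [IsFiniteMeasureOnCompacts ν] {S : Set Y} (hS : IsCompact S) {s : Y → E} (hs : Continuous s)
    (hshift : ∀ x ∈ Ω, ∀ y ∈ S, x + s y ∈ Ω) {g : Y → ℝ} (hg : Continuous g)
    (hτ : LocallyIntegrableOn τ Ω μ) (φ : 𝓓(Ω, ℝ)) :
    ∫ x, τ x * (∫ y in S, g y * φ (x - s y) ∂ν) ∂μ =
      ∫ y in S, g y * (∫ x, τ x * φ (x - s y) ∂μ) ∂ν := by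
  let K : Set E := (fun p : E × Y => p.1 + s p.2) '' (tsupport φ ×ˢ S)
  have hK : IsCompact K := (φ.hasCompactSupport.prod hS).image (by fun_prop)
  have hKΩ : K ⊆ Ω := by
    rintro _ ⟨p, ⟨hp, hpS⟩, rfl⟩
    exact hshift _ (φ.tsupport_subset hp) _ hpS
  have hφK {x : E} (hx : x ∉ K) {y : Y} (hy : y ∈ S) : φ (x - s y) = 0 :=
    image_eq_zero_of_notMem_tsupport fun hxy => hx ⟨(x - s y, y), ⟨hxy, hy⟩, sub_add_cancel _ _⟩
  have hcut (x : E) {y : Y} (hy : y ∈ S) :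
      τ x * φ (x - s y) = K.indicator τ x * φ (x - s y) := by
    by_cases hx : x ∈ K
    · rw [Set.indicator_of_mem hx]
    · rw [hφK hx hy, mul_zero, mul_zero]
  obtain ⟨B, hB⟩ := φ.hasCompactSupport.exists_bound_of_continuous φ.continuous
  have hτK : Integrable (K.indicator τ) μ :=
    (integrable_indicator_iff hK.measurableSet).2 (hτ.integrableOn_compact_subset hKΩ hK)
  have hgS : IntegrableOn g S ν := hg.continuousOn.integrableOn_compact hS
  have : IsFiniteMeasure (ν.restrict S) := isFiniteMeasure_restrict.2 hS.measure_lt_top.ne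
  have hprod : Integrable (fun p : E × Y => φ (p.1 - s p.2) * (K.indicator τ p.1 * g p.2))
      (μ.prod (ν.restrict S)) :=
    (hτK.mul_prod hgS).bdd_mul (Continuous.aestronglyMeasurable (by fun_prop))
      (.of_forall fun p => hB _)
  calc ∫ x, τ x * (∫ y in S, g y * φ (x - s y) ∂ν) ∂μ
      = ∫ x, (∫ y in S, φ (x - s y) * (K.indicator τ x * g y) ∂ν) ∂μ := by
        congr! 2 with x
        rw [← integral_const_mul]
        refine setIntegral_congr_fun hS.measurableSet fun y hy => ?_
        linear_combination g y * hcut x hy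
    _ = ∫ y in S, (∫ x, φ (x - s y) * (K.indicator τ x * g y) ∂μ) ∂ν :=
        integral_integral_swap hprod
    _ = ∫ y in S, g y * (∫ x, τ x * φ (x - s y) ∂μ) ∂ν := by
        refine setIntegral_congr_fun hS.measurableSet fun y hy => ?_
        simp only [← integral_const_mul]
        congr with x
        linear_combination -g y * hcut x hy

lemma integral_mul_comp_sub_eq [SFinite μ] (hτ : LocallyIntegrableOn τ Ω μ) {h : E}
    (hray : ∀ x ∈ Ω, ∀ t : ℝ, 0 ≤ t → x + t • h ∈ Ω)
    (hgrad : ∀ φ : 𝓓(Ω, ℝ), ∫ x, τ x * (∂_{h} φ) x ∂μ = 0) (φ : 𝓓(Ω, ℝ)) :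
    ∫ x, τ x * φ (x - h) ∂μ = ∫ x, τ x * φ x ∂μ := by
  have hslice {t : ℝ} (ht : 0 ≤ t) : ∫ x, τ x * (∂_{h} φ) (x - t • h) ∂μ = 0 := by
    rw [← hgrad (translate φ (t • h) fun x hx => hray x hx t ht)]
    congr! 3 with x
    rw [lineDerivOp_apply_eq_fderiv, lineDerivOp_apply_eq_fderiv]
    exact congrArg (fun L : E →L[ℝ] ℝ => L h) (fderiv_comp_sub (t • h)).symm
  have hdiff : ∫ x, τ x * (φ (x - h) - φ x) ∂μ = 0 := by
    simp only [← setIntegral_neg_lineDerivOp_sub_smul]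
    rw [integral_mul_setIntegral_comp_sub (ν := volume) isCompact_Icc (by fun_prop)
      (fun x hx t ht => hray x hx t ht.1) continuous_const hτ]
    exact setIntegral_eq_zero_of_forall_eq_zero fun t ht => by rw [hslice ht.1, mul_zero]
  have hint (ψ : 𝓓(Ω, ℝ)) : Integrable (fun x => τ x * ψ x) μ :=
    integrable_mul_of_tsupport_subset hτ ψ.continuous ψ.hasCompactSupport ψ.tsupport_subset
  have hh : ∀ x ∈ Ω, x + h ∈ Ω := fun x hx => by simpa using hray x hx 1 zero_le_one
  simp only [mul_sub] at hdiff
  exact sub_eq_zero.1 ((integral_sub (hint (translate φ h hh)) (hint φ)).symm.trans hdiff)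

lemma integral_mul_convolution [SecondCountableTopology E] [SFinite μ]
    [IsFiniteMeasureOnCompacts μ]
    (hτ : LocallyIntegrableOn τ Ω μ) (hadd : ∀ x ∈ Ω, ∀ y ∈ Ω, x + y ∈ Ω) {φ : 𝓓(Ω, ℝ)}
    (hinv : ∀ h ∈ Ω, ∫ x, τ x * φ (x - h) ∂μ = ∫ x, τ x * φ x ∂μ) (ψ : 𝓓(Ω, ℝ)) :
    ∫ x, τ x * (∫ y, ψ y * φ (x - y) ∂μ) ∂μ = (∫ x, τ x * φ x ∂μ) * ∫ y, ψ y ∂μ := by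
  have hψ {y : E} (hy : y ∉ tsupport ψ) : ψ y = 0 := image_eq_zero_of_notMem_tsupport hy
  calc ∫ x, τ x * (∫ y, ψ y * φ (x - y) ∂μ) ∂μ
      = ∫ x, τ x * (∫ y in tsupport ψ, ψ y * φ (x - y) ∂μ) ∂μ := by
        congr! 3 with x
        exact (setIntegral_eq_integral_of_forall_compl_eq_zero fun y hy => by
          rw [hψ hy, zero_mul]).symm
    _ = ∫ y in tsupport ψ, ψ y * (∫ x, τ x * φ (x - y) ∂μ) ∂μ :=
        integral_mul_setIntegral_comp_sub ψ.hasCompactSupport continuous_id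
          (fun x hx y hy => hadd x hx y (ψ.tsupport_subset hy)) ψ.continuous hτ φ
    _ = ∫ y in tsupport ψ, ψ y * (∫ x, τ x * φ x ∂μ) ∂μ :=
        setIntegral_congr_fun (isClosed_tsupport ψ).measurableSet fun y hy => by
          rw [hinv y (ψ.tsupport_subset hy)]
    _ = (∫ x, τ x * φ x ∂μ) * ∫ y, ψ y ∂μ := by
        rw [integral_mul_const, mul_comm,
          setIntegral_eq_integral_of_forall_compl_eq_zero fun y hy => hψ hy]

lemma exists_testFunction_integral_eq_one [FiniteDimensional ℝ E] [μ.IsAddHaarMeasure]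
    (hne : (Ω : Set E).Nonempty) : ∃ ψ : 𝓓(Ω, ℝ), ∫ x, ψ x ∂μ = 1 := by
  obtain ⟨x₀, hx₀⟩ := hne
  obtain ⟨r, hr, hball⟩ := Metric.isOpen_iff.1 Ω.isOpen x₀ hx₀
  let b : ContDiffBump x₀ := ⟨r / 4, r / 2, by positivity, by linarith⟩
  refine ⟨⟨b.normed μ, b.contDiff_normed, b.hasCompactSupport_normed, ?_⟩, b.integral_normed⟩
  rw [b.tsupport_normed_eq]
  exact (Metric.closedBall_subset_ball (half_lt_self hr)).trans hball

/-- Translation invariance makes the pairing of `τ` with a convolution `φ ⋆ ψ` equal to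
`(∫ τ φ) (∫ ψ)`; since convolution is commutative, `∫ τ φ` is proportional to `∫ φ`. -/
theorem exists_ae_eq_const_of_integral_mul_lineDerivOp_eq_zero [FiniteDimensional ℝ E]
    [μ.IsAddHaarMeasure] (hne : (Ω : Set E).Nonempty)
    (hcone : ∀ x ∈ Ω, ∀ h ∈ Ω, ∀ t : ℝ, 0 ≤ t → x + t • h ∈ Ω)
    (hτ : LocallyIntegrableOn τ Ω μ)
    (hgrad : ∀ (φ : 𝓓(Ω, ℝ)) (h : E), ∫ x, τ x * (∂_{h} φ) x ∂μ = 0) :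
    ∃ c, ∀ᵐ x ∂μ, x ∈ Ω → τ x = c := by
  have hadd : ∀ x ∈ Ω, ∀ y ∈ Ω, x + y ∈ Ω := fun x hx y hy => by
    simpa using hcone x hx y hy 1 zero_le_one
  have hconv (φ ψ : 𝓓(Ω, ℝ)) :
      ∫ x, τ x * (∫ y, ψ y * φ (x - y) ∂μ) ∂μ = (∫ x, τ x * φ x ∂μ) * ∫ y, ψ y ∂μ :=
    integral_mul_convolution hτ hadd (fun h hh =>
      integral_mul_comp_sub_eq hτ (fun x hx => hcone x hx h hh) (fun φ => hgrad φ h) φ) ψ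
  have hsymm (φ ψ : 𝓓(Ω, ℝ)) :
      (∫ x, τ x * φ x ∂μ) * ∫ y, ψ y ∂μ = (∫ x, τ x * ψ x ∂μ) * ∫ y, φ y ∂μ := by
    rw [← hconv, ← hconv]
    congr! 3 with x
    rw [← integral_sub_left_eq_self _ μ x]
    simp only [sub_sub_cancel, mul_comm]
  obtain ⟨ψ, hψ⟩ := exists_testFunction_integral_eq_one (μ := μ) hne
  set c := ∫ x, τ x * ψ x ∂μ
  have hτc : LocallyIntegrableOn (fun x => τ x - c) Ω μ :=
    hτ.sub ((locallyIntegrable_const (μ := μ) c).locallyIntegrableOn Ω)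
  refine ⟨c, (Ω.isOpen.ae_eq_zero_of_integral_contDiff_smul_eq_zero hτc
    fun φ hφ hφc hφs => ?_).mono fun x hx hxΩ => sub_eq_zero.1 (hx hxΩ)⟩
  have hφψ := hsymm ⟨φ, hφ, hφc, hφs⟩ ψ
  rw [hψ, mul_one] at hφψ
  simp only [smul_eq_mul, mul_comm (φ _), sub_mul]
  rw [integral_sub (integrable_mul_of_tsupport_subset hτ hφ.continuous hφc hφs)
    ((hφ.continuous.integrable_of_hasCompactSupport hφc).const_mul c), integral_const_mul]
  exact sub_eq_zero.2 hφψ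

end WeakGradient

/-! ### Uniqueness of the entropy flux kernel -/

section FluxUniqueness

open TopologicalSpace
open scoped Distributions LineDeriv

variable {ε : ℝ} {χ σ σ' : ℝ × ℝ → ℝ} {Ω : Opens (ℝ × ℝ)}

lemma lineDerivOp_prod_eq (φ : 𝓓(Ω, ℝ)) (v x : ℝ × ℝ) :
    (∂_{v} φ) x = v.1 * dw φ x + v.2 * dz φ x := by
  have hφ : Differentiable ℝ φ := φ.contDiff.differentiable (by simp)
  rw [lineDerivOp_apply_eq_fderiv, fderiv_eq_dw_dz hφ]
  simp [mul_comm]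

lemma IsEntropyFluxKernel.integral_sub_mul_lineDerivOp (h : IsEntropyFluxKernel ε χ σ)
    (h' : IsEntropyFluxKernel ε χ σ') (hΩ : (Ω : Set (ℝ × ℝ)) ⊆ nonunitDensity) (φ : 𝓓(Ω, ℝ))
    (v : ℝ × ℝ) : ∫ x, (σ x - σ' x) * (∂_{v} φ) x = 0 := by
  have htest : IsTestFunction nonunitDensity φ :=
    ⟨φ.contDiff, φ.hasCompactSupport, φ.tsupport_subset.trans hΩ⟩
  have hint {τ : ℝ × ℝ → ℝ} (hτ : LocallyIntegrableOn τ nonunitDensity) (e : ℝ × ℝ) :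
      Integrable fun x => τ x * (∂_{e} φ : 𝓓(Ω, ℝ)) x :=
    integrable_mul_of_tsupport_subset hτ (∂_{e} φ : 𝓓(Ω, ℝ)).continuous
      (∂_{e} φ : 𝓓(Ω, ℝ)).hasCompactSupport ((∂_{e} φ : 𝓓(Ω, ℝ)).tsupport_subset.trans hΩ)
  have hw : ∫ x, σ x * dw φ x = ∫ x, σ' x * dw φ x :=
    neg_injective ((h.eq_w φ htest).trans (h'.eq_w φ htest).symm)
  have hz : ∫ x, σ x * dz φ x = ∫ x, σ' x * dz φ x :=
    neg_injective ((h.eq_z φ htest).trans (h'.eq_z φ htest).symm)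
  have hsplit {τ : ℝ × ℝ → ℝ} (hτ : LocallyIntegrableOn τ nonunitDensity) :
      ∫ x, τ x * (∂_{v} φ) x = v.1 * (∫ x, τ x * dw φ x) + v.2 * ∫ x, τ x * dz φ x := by
    have iw := hint hτ (1, 0)
    have iz := hint hτ (0, 1)
    simp only [lineDerivOp_prod_eq, one_mul, zero_mul, add_zero, zero_add] at iw iz ⊢
    simp only [mul_add, mul_left_comm (τ _)]
    rw [integral_add (iw.const_mul _) (iz.const_mul _), integral_const_mul, integral_const_mul]
  simp only [sub_mul]
  rw [integral_sub (hint h.locallyIntegrableOn v) (hint h'.locallyIntegrableOn v),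
    hsplit h.locallyIntegrableOn, hsplit h'.locallyIntegrableOn, hw, hz, sub_self]

lemma IsEntropyFluxKernel.ae_eq_on (h : IsEntropyFluxKernel ε χ σ)
    (h' : IsEntropyFluxKernel ε χ σ') (hΩ : (Ω : Set (ℝ × ℝ)) ⊆ nonunitDensity)
    (hcone : ∀ x ∈ Ω, ∀ v ∈ Ω, ∀ t : ℝ, 0 ≤ t → x + t • v ∈ Ω)
    (hacc : (0, 0) ∈ closure (Ω ∩ {x : ℝ × ℝ | x.1 * x.2 < 0})) :
    ∀ᵐ x, x ∈ Ω → σ x = σ' x := by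
  have hne : (Ω : Set (ℝ × ℝ)).Nonempty :=
    (closure_nonempty_iff.1 ⟨_, hacc⟩).mono Set.inter_subset_left
  obtain ⟨c, hc⟩ := exists_ae_eq_const_of_integral_mul_lineDerivOp_eq_zero (μ := volume) hne hcone
    ((h.locallyIntegrableOn.sub h'.locallyIntegrableOn).mono_set hΩ)
    (h.integral_sub_mul_lineDerivOp h' hΩ)
  have hlim : Tendsto (fun x => σ x - σ' x) (𝓝[{x : ℝ × ℝ | x.1 * x.2 < 0}] (0, 0)) (𝓝 0) := by
    simpa [sharp] using h.sharp_zero.sub h'.sharp_zero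
  have hc0 : c = 0 := by
    by_contra hc0
    obtain ⟨U, hU, h0U, hball⟩ :=
      mem_nhdsWithin.1 (hlim.eventually_ne (Ne.symm hc0))
    obtain ⟨y, hyU, hyΩ, hyneg⟩ := mem_closure_iff.1 hacc U hU h0U
    have hopen : IsOpen (U ∩ (Ω ∩ {x : ℝ × ℝ | x.1 * x.2 < 0})) :=
      hU.inter (Ω.isOpen.inter (isOpen_lt (by fun_prop) (by fun_prop)))
    obtain ⟨x, ⟨hxU, hxΩ, hxneg⟩, hxc⟩ :=
      (Measure.dense_of_ae hc).inter_open_nonempty _ hopen ⟨y, hyU, hyΩ, hyneg⟩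
    exact hball ⟨hxU, hxneg⟩ (hxc hxΩ)
  filter_upwards [hc] with x hx hxΩ
  exact sub_eq_zero.1 ((hx hxΩ).trans hc0)

theorem IsEntropyFluxKernel.ae_eq (h : IsEntropyFluxKernel ε χ σ)
    (h' : IsEntropyFluxKernel ε χ σ') : σ =ᵐ[volume] σ' := by
  have hside (s : ℝ) (hs : s ≠ 0) : ∀ᵐ x : ℝ × ℝ, 0 < s * (x.2 - x.1) → σ x = σ' x := by
    refine h.ae_eq_on h' (Ω := ⟨{x | 0 < s * (x.2 - x.1)}, isOpen_lt (by fun_prop) (by fun_prop)⟩)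
      (fun x hx hx' => ?_) (fun x hx v hv t ht => ?_) ?_
    · have hx : 0 < s * (x.2 - x.1) := hx
      simp [show x.1 = x.2 from hx'] at hx
    · have hx : 0 < s * (x.2 - x.1) := hx
      have hv : 0 < s * (v.2 - v.1) := hv
      change 0 < s * ((x.2 + t * v.2) - (x.1 + t * v.1))
      linarith [mul_nonneg ht hv.le]
    · have hlim : Tendsto (fun t : ℝ => (-(s * t), s * t)) (𝓝[>] 0) (𝓝 (0, 0)) :=
        (Continuous.tendsto' (by fun_prop) 0 (0, 0) (by simp)).mono_left nhdsWithin_le_nhds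
      refine mem_closure_of_tendsto hlim (eventually_mem_nhdsWithin.mono fun t ht => ⟨?_, ?_⟩)
      · have ht : 0 < t := ht
        change 0 < s * (s * t - -(s * t))
        nlinarith [mul_pos (mul_self_pos.2 hs) ht]
      · have hst : s * t ≠ 0 := mul_ne_zero hs (ne_of_gt ht)
        change -(s * t) * (s * t) < 0
        nlinarith [mul_self_pos.2 hst]
  filter_upwards [hside 1 one_ne_zero, hside (-1) (by norm_num), ae_fst_ne_snd] with x hlt hgt hx
  rcases lt_or_gt_of_ne hx with h | h
  · exact hlt (by linarith)
  · exact hgt (by linarith)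

lemma IsEntropyFluxKernel.integral_sharp_mul_eq (h : IsEntropyFluxKernel ε χ σ)
    (h' : IsEntropyFluxKernel ε χ σ') (ψ : ℝ × ℝ → ℝ) :
    ∫ x, sharp χ σ x * ψ x = ∫ x, sharp χ σ' x * ψ x :=
  integral_congr_ae ((h.ae_eq h').mono fun x hx => by simp only [sharp, hx])

end FluxUniqueness

/-! ### Construction of the entropy flux kernel -/

namespace IsTestFunction

variable {Ω : Set (ℝ × ℝ)} {φ : ℝ × ℝ → ℝ}

lemma contDiff_one (hφ : IsTestFunction Ω φ) : ContDiff ℝ 1 φ := contDiff_infty.1 hφ.contDiff 1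

lemma apply_diag (hφ : IsTestFunction nonunitDensity φ) (z : ℝ) : φ (z, z) = 0 :=
  image_eq_zero_of_notMem_tsupport fun hz => hφ.tsupport_subset hz rfl

end IsTestFunction

/-- The flux kernel obtained from a flux `F` of the Riemann function that vanishes at the origin:
the extension of `F` from `w z ≤ 0` to a function that is `±1` on the components of `w z > 0`,
`w ≠ z`, where the entropy kernel vanishes. -/
noncomputable def fluxKernel (F : ℝ × ℝ → ℝ) (x : ℝ × ℝ) : ℝ :=
  if x.1 * x.2 ≤ 0 then F x else Real.sign x.2 * Real.sign (x.1 - x.2)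

section FluxKernel

variable {F G φ : ℝ × ℝ → ℝ}

lemma fluxKernel_of_nonpos {x : ℝ × ℝ} (hx : x.1 * x.2 ≤ 0) : fluxKernel F x = F x := if_pos hx

lemma sign_mul_sign_of_mul_neg {s t : ℝ} (h : s * t < 0) :
    Real.sign t * Real.sign (s - t) = -1 := by
  rcases mul_neg_iff.1 h with ⟨hs, ht⟩ | ⟨hs, ht⟩
  · rw [Real.sign_of_neg ht, Real.sign_of_pos (by linarith), mul_one]
  · rw [Real.sign_of_pos ht, Real.sign_of_neg (by linarith), one_mul]

lemma sign_eq_of_mul_pos {s t : ℝ} (h : 0 < s * t) : Real.sign s = Real.sign t := by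
  rcases mul_pos_iff.1 h with ⟨hs, ht⟩ | ⟨hs, ht⟩
  · rw [Real.sign_of_pos hs, Real.sign_of_pos ht]
  · rw [Real.sign_of_neg hs, Real.sign_of_neg ht]

lemma fluxKernel_eq_sign_snd_add {x : ℝ × ℝ} (hx : x.1 * x.2 ≠ 0) :
    fluxKernel F x = 1 * (Real.sign x.2 * Real.sign (x.1 - x.2)) +
      Set.indicator {x : ℝ × ℝ | x.1 * x.2 < 0} (fun x => F x + 1) x := by
  rcases hx.lt_or_gt with hx | hx
  · rw [fluxKernel_of_nonpos hx.le, sign_mul_sign_of_mul_neg hx, Set.indicator_of_mem (by exact hx)]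
    ring
  · simp [fluxKernel, hx.not_ge, hx.not_gt]

lemma fluxKernel_eq_sign_fst_add {x : ℝ × ℝ} (hx : x.1 * x.2 ≠ 0) :
    fluxKernel F x = -1 * (Real.sign x.1 * Real.sign (x.2 - x.1)) +
      Set.indicator {x : ℝ × ℝ | x.1 * x.2 < 0} (fun x => F x - 1) x := by
  rcases hx.lt_or_gt with hx | hx
  · rw [fluxKernel_of_nonpos hx.le, sign_mul_sign_of_mul_neg (mul_comm x.1 x.2 ▸ hx),
      Set.indicator_of_mem (by exact hx)]
    ring
  · rw [← neg_sub x.1 x.2, Real.sign_neg, sign_eq_of_mul_pos hx]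
    simp [fluxKernel, hx.not_ge, hx.not_gt]

lemma locallyIntegrable_fluxKernel (hF : Continuous F) : LocallyIntegrable (fluxKernel F) := by
  have hsign := measurable_sign
  have hle : MeasurableSet {x : ℝ × ℝ | x.1 * x.2 ≤ 0} :=
    measurableSet_le (by fun_prop) (by fun_prop)
  refine (hF.norm.locallyIntegrable.add (locallyIntegrable_const (1 : ℝ))).mono
    (Measurable.ite hle hF.measurable (by fun_prop)).aestronglyMeasurable (.of_forall fun x => ?_)
  have hbound : ‖Real.sign x.2 * Real.sign (x.1 - x.2)‖ ≤ 1 :=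
    (norm_mul_le _ _).trans (mul_le_one₀ (abs_sign_le_one _) (norm_nonneg _) (abs_sign_le_one _))
  refine le_trans ?_ (le_abs_self (‖F x‖ + 1))
  unfold fluxKernel
  split_ifs
  · linarith
  · linarith [norm_nonneg (F x)]

lemma integral_fluxKernel_mul_dw (hG : ContDiff ℝ 1 G) (hφ : IsTestFunction nonunitDensity φ) :
    -∫ x, fluxKernel G x * dw φ x = (∫ x in {x : ℝ × ℝ | x.1 * x.2 < 0}, dw G x * φ x) -
      ∫ z, Real.sign z * ((G (0, z) + 1) * φ (0, z)) := by
  rw [integral_piecewise_mul_dw (hG.add contDiff_const) hφ.contDiff_one hφ.hasCompactSupport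
    hφ.apply_diag 1 fun x hx => fluxKernel_eq_sign_snd_add hx]
  simp only [dw, deriv_add_const]

lemma integral_fluxKernel_mul_dz (hG : ContDiff ℝ 1 G) (hφ : IsTestFunction nonunitDensity φ) :
    -∫ x, fluxKernel G x * dz φ x = (∫ x in {x : ℝ × ℝ | x.1 * x.2 < 0}, dz G x * φ x) -
      ∫ w, Real.sign w * ((G (w, 0) - 1) * φ (w, 0)) := by
  rw [integral_piecewise_mul_dz (hG.sub contDiff_const) hφ.contDiff_one hφ.hasCompactSupport
    hφ.apply_diag (-1) fun x hx => fluxKernel_eq_sign_fst_add hx]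
  simp only [dz, deriv_sub_const]

end FluxKernel

section EntropyKernel

variable {ε : ℝ} {R : ℝ → ℝ → ℝ → ℝ → ℝ} {F φ : ℝ × ℝ → ℝ}

lemma entropyKernel_eq_indicator {x : ℝ × ℝ} (hx : x.1 * x.2 ≠ 0) :
    entropyKernel R x = Set.indicator {x : ℝ × ℝ | x.1 * x.2 < 0} (fun x => R 0 0 x.1 x.2) x := by
  simp only [entropyKernel, Set.indicator, hx.le_iff_lt, Set.mem_ofPred_eq]

lemma integral_entropyKernel_mul_dw (hu : ContDiff ℝ 1 fun x : ℝ × ℝ => R 0 0 x.1 x.2)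
    (hφ : ContDiff ℝ 1 φ) (hc : HasCompactSupport φ) (hdiag : ∀ z, φ (z, z) = 0) :
    -∫ x, entropyKernel R x * dw φ x =
      (∫ x in {x : ℝ × ℝ | x.1 * x.2 < 0}, dw (fun x => R 0 0 x.1 x.2) x * φ x) -
        ∫ z, Real.sign z * (R 0 0 0 z * φ (0, z)) :=
  integral_piecewise_mul_dw hu hφ hc hdiag 0 fun x hx => by
    rw [entropyKernel_eq_indicator hx, zero_mul, zero_add]

lemma integral_entropyKernel_mul_dz (hu : ContDiff ℝ 1 fun x : ℝ × ℝ => R 0 0 x.1 x.2)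
    (hφ : ContDiff ℝ 1 φ) (hc : HasCompactSupport φ) (hdiag : ∀ z, φ (z, z) = 0) :
    -∫ x, entropyKernel R x * dz φ x =
      (∫ x in {x : ℝ × ℝ | x.1 * x.2 < 0}, dz (fun x => R 0 0 x.1 x.2) x * φ x) -
        ∫ w, Real.sign w * (R 0 0 w 0 * φ (w, 0)) :=
  integral_piecewise_mul_dz hu hφ hc hdiag 0 fun x hx => by
    rw [entropyKernel_eq_indicator hx, zero_mul, zero_add]

lemma sharp_fluxKernel : sharp (entropyKernel R) (fluxKernel F) =
    fluxKernel (sharp (fun x => R 0 0 x.1 x.2) F) := by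
  ext x
  by_cases hx : x.1 * x.2 ≤ 0 <;> simp [sharp, entropyKernel, fluxKernel, hx]

lemma contDiff_sharp {u : ℝ × ℝ → ℝ} (hu : ContDiff ℝ ∞ u) (hF : ContDiff ℝ ∞ F) :
    ContDiff ℝ ∞ (sharp u F) := by
  unfold sharp
  fun_prop

lemma abs_eq_sign_mul (t : ℝ) : |t| = Real.sign t * t := by
  rcases lt_trichotomy t 0 with ht | rfl | ht
  · rw [abs_of_neg ht, Real.sign_of_neg ht, neg_one_mul]
  · simp
  · rw [abs_of_pos ht, Real.sign_of_pos ht, one_mul]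

variable (h0 : 0 < ε) (h1 : ε < 1)
include h0 h1

lemma sign_mul_mul_goursatDataSnd (z : ℝ) :
    Real.sign z * ((lam2 ε 0 z - z / 2) * goursatDataSnd ε 0 0 z) =
      -(C5 ε z * Real.exp (-(1 + ε) ^ 2 * z / 4)) := by
  have hB := (fastDenom_pos h0 h1 z).ne'
  rw [lam2_eq_div h0 h1, goursatDataSnd, C5, abs_eq_sign_mul, sub_zero, add_zero, zero_add,
    show -((1 + ε) ^ 2 / 4 * z) = -(1 + ε) ^ 2 * z / 4 by ring]
  simp only [fastDenom, mul_zero, Real.exp_zero, mul_one] at hB ⊢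
  field_simp
  ring

lemma sign_mul_mul_goursatDataFst (w : ℝ) :
    Real.sign w * ((lam1 ε w 0 - w / 2) * goursatDataFst ε 0 0 w) =
      -(C6 ε w * Real.exp ((1 - ε) ^ 2 * w / 4)) := by
  have hA := (slowDenom_pos h0 h1 w).ne'
  rw [lam1_eq, add_zero, lam1_eq_div h0 h1, goursatDataFst, C6, abs_eq_sign_mul, sub_zero, add_zero,
    add_zero, show (1 - ε) ^ 2 / 4 * w = (1 - ε) ^ 2 * w / 4 by ring]
  simp only [slowDenom, mul_zero, Real.exp_zero, mul_one] at hA ⊢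
  field_simp
  ring

namespace IsRiemannFunction

lemma isGoursatSolution (hR : IsRiemannFunction ε R) (w₀ z₀ : ℝ) :
    IsGoursatSolution (aBar ε) (bBar ε) w₀ z₀ fun x => R w₀ z₀ x.1 x.2 := by
  obtain ⟨u, -, hu⟩ := exists_isGoursatSolution h0 h1 w₀ z₀
  simpa only [hR.apply_eq h0 h1 hu] using hu

lemma contDiff_pole (hR : IsRiemannFunction ε R) (w₀ z₀ : ℝ) :
    ContDiff ℝ ∞ fun x : ℝ × ℝ => R w₀ z₀ x.1 x.2 := by
  obtain ⟨u, hcu, hu⟩ := exists_isGoursatSolution h0 h1 w₀ z₀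
  simpa only [hR.apply_eq h0 h1 hu] using hcu

variable (hR : IsRiemannFunction ε R)
  (hF : IsFlux (lam1 ε 0) (lam2 ε 0) 0 0 (fun x => R 0 0 x.1 x.2) F)
include hR hF

lemma contDiff_flux : ContDiff ℝ ∞ F :=
  hF.contDiff (hR.contDiff_pole h0 h1 0 0) ((contDiff_lam1 h0 h1).comp (contDiff_prodMk_right 0))
    ((contDiff_lam2 h0 h1).comp (contDiff_prodMk_right 0))

lemma flux_apply_fst (w : ℝ) : F (w, 0) = lam1 ε w 0 * R 0 0 w 0 + 1 := by
  have hF₀ := hF.apply_fst (hR.isGoursatSolution h0 h1 0 0) (hasDerivAt_lam1 h0 h1) w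
  have hl : lam1 ε 0 0 = -1 := by
    simp only [lam1, add_zero, mul_zero, Real.exp_zero]
    field_simp
    ring
  rw [hF₀, lam1_eq ε w, add_zero 0, hl, sub_neg_eq_add]

lemma flux_apply_snd (z : ℝ) : F (0, z) = lam2 ε 0 z * R 0 0 0 z - 1 := by
  have hF₀ := hF.apply_snd (hR.isGoursatSolution h0 h1 0 0) (hasDerivAt_lam2 h0 h1) z
  have hl : lam2 ε 0 0 = 1 := by
    simp only [lam2, add_zero, mul_zero, Real.exp_zero]
    field_simp
    ring
  rw [hF₀, zero_add, zero_add, hl]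

theorem isEntropyFluxKernel_fluxKernel :
    IsEntropyFluxKernel ε (entropyKernel R) (fluxKernel F) where
  locallyIntegrableOn :=
    (locallyIntegrable_fluxKernel hF.differentiable.continuous).locallyIntegrableOn _
  eq_w φ hφ := by
    rw [integral_fluxKernel_mul_dw (contDiff_infty.1 (hR.contDiff_flux h0 h1 hF) 1) hφ,
      integral_entropyKernel_mul_dw (contDiff_infty.1 (hR.contDiff_pole h0 h1 0 0) 1)
        (contDiff_infty.1 ((contDiff_lam2 h0 h1).mul hφ.contDiff) 1)
        hφ.hasCompactSupport.mul_left fun z => by rw [hφ.apply_diag, mul_zero]]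
    congr! 3 with x z
    · rw [hF.dw_eq, ← lam2_eq]
      ring
    · rw [hR.flux_apply_snd h0 h1 hF]
      ring
  eq_z φ hφ := by
    rw [integral_fluxKernel_mul_dz (contDiff_infty.1 (hR.contDiff_flux h0 h1 hF) 1) hφ,
      integral_entropyKernel_mul_dz (contDiff_infty.1 (hR.contDiff_pole h0 h1 0 0) 1)
        (contDiff_infty.1 ((contDiff_lam1 h0 h1).mul hφ.contDiff) 1)
        hφ.hasCompactSupport.mul_left fun z => by rw [hφ.apply_diag, mul_zero]]
    congr! 3 with x w
    · rw [hF.dz_eq, ← lam1_eq]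
      ring
    · rw [hR.flux_apply_fst h0 h1 hF]
      ring
  sharp_zero := by
    have hsharp := (contDiff_sharp (hR.contDiff_pole h0 h1 0 0)
      (hR.contDiff_flux h0 h1 hF)).continuous.tendsto' (0, 0) 0 (by simp [sharp, hF.at_pole])
    rw [sharp_fluxKernel]
    refine (hsharp.mono_left nhdsWithin_le_nhds).congr' ?_
    filter_upwards [self_mem_nhdsWithin] with x hx
    exact (fluxKernel_of_nonpos (le_of_lt hx)).symm

lemma dw_sharp {x : ℝ × ℝ} (hx : x.1 * x.2 < 0) :
    dw (sharp (fun x => R 0 0 x.1 x.2) F) x = C3 ε R x := by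
  have hu := (hR.isGoursatSolution h0 h1 0 0).differentiable
  refine ((hasDerivAt_dw (hF.differentiable x)).sub
    ((((hasDerivAt_id x.1).add_const x.2).div_const 2).mul (hasDerivAt_dw (hu x)))).deriv.trans ?_
  have hC : C1 R x = dw (fun x => R 0 0 x.1 x.2) x := rfl
  rw [hF.dw_eq, ← lam2_eq, C3, hC, entropyKernel, if_pos hx.le]
  simp only [id_eq]
  ring

theorem integral_sharp_mul_dw (hφ : IsTestFunction nonunitDensity φ) :
    -∫ x, sharp (entropyKernel R) (fluxKernel F) x * dw φ x =
      (∫ z, C5 ε z * Real.exp (-(1 + ε) ^ 2 * z / 4) * φ (0, z)) +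
        ∫ x in {x : ℝ × ℝ | x.1 * x.2 < 0}, C3 ε R x * φ x := by
  have hsharp := contDiff_sharp (hR.contDiff_pole h0 h1 0 0) (hR.contDiff_flux h0 h1 hF)
  have hline (z : ℝ) : Real.sign z * ((sharp (fun x => R 0 0 x.1 x.2) F (0, z) + 1) * φ (0, z)) =
      -(C5 ε z * Real.exp (-(1 + ε) ^ 2 * z / 4) * φ (0, z)) := by
    rw [← neg_mul, ← sign_mul_mul_goursatDataSnd h0 h1,
      ← (hR.isGoursatSolution h0 h1 0 0).apply_snd h0 h1, sharp,
      hR.flux_apply_snd h0 h1 hF]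
    ring
  rw [sharp_fluxKernel, integral_fluxKernel_mul_dw (contDiff_infty.1 hsharp 1) hφ,
    setIntegral_congr_fun measurableSet_mul_neg fun x hx => by rw [hR.dw_sharp h0 h1 hF hx]]
  simp only [hline, integral_neg]
  ring

lemma dz_sharp {x : ℝ × ℝ} (hx : x.1 * x.2 < 0) :
    dz (sharp (fun x => R 0 0 x.1 x.2) F) x = C4 ε R x := by
  have hu := (hR.isGoursatSolution h0 h1 0 0).differentiable
  refine ((hasDerivAt_dz (hF.differentiable x)).sub
    ((((hasDerivAt_id x.2).const_add x.1).div_const 2).mul (hasDerivAt_dz (hu x)))).deriv.trans ?_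
  have hC : C2 R x = dz (fun x => R 0 0 x.1 x.2) x := rfl
  rw [hF.dz_eq, ← lam1_eq, C4, hC, entropyKernel, if_pos hx.le]
  simp only [id_eq]
  ring

theorem integral_sharp_mul_dz (hφ : IsTestFunction nonunitDensity φ) :
    -∫ x, sharp (entropyKernel R) (fluxKernel F) x * dz φ x =
      (∫ w, C6 ε w * Real.exp ((1 - ε) ^ 2 * w / 4) * φ (w, 0)) +
        ∫ x in {x : ℝ × ℝ | x.1 * x.2 < 0}, C4 ε R x * φ x := by
  have hsharp := contDiff_sharp (hR.contDiff_pole h0 h1 0 0) (hR.contDiff_flux h0 h1 hF)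
  have hline (w : ℝ) : Real.sign w * ((sharp (fun x => R 0 0 x.1 x.2) F (w, 0) - 1) * φ (w, 0)) =
      -(C6 ε w * Real.exp ((1 - ε) ^ 2 * w / 4) * φ (w, 0)) := by
    rw [← neg_mul, ← sign_mul_mul_goursatDataFst h0 h1,
      ← (hR.isGoursatSolution h0 h1 0 0).apply_fst h0 h1, sharp,
      hR.flux_apply_fst h0 h1 hF]
    ring
  rw [sharp_fluxKernel, integral_fluxKernel_mul_dz (contDiff_infty.1 hsharp 1) hφ,
    setIntegral_congr_fun measurableSet_mul_neg fun x hx => by rw [hR.dz_sharp h0 h1 hF hx]]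
  simp only [hline, integral_neg]
  ring

end IsRiemannFunction

end EntropyKernel

end RelEuler

theorem lemma3p4 (ε : ℝ) (hε0 : 0 < ε) (hε1 : ε < 1) :
    (∃! R, RelEuler.IsRiemannFunction ε R) ∧
    ∀ R, RelEuler.IsRiemannFunction ε R →
      ContDiff ℝ ∞ (fun p : ℝ × ℝ => R 0 0 p.1 p.2) ∧
      (∃ σ, RelEuler.IsEntropyFluxKernel ε (RelEuler.entropyKernel R) σ) ∧
      (∀ σ σ', RelEuler.IsEntropyFluxKernel ε (RelEuler.entropyKernel R) σ →
        RelEuler.IsEntropyFluxKernel ε (RelEuler.entropyKernel R) σ' → σ =ᵐ[volume] σ') ∧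
      ∀ σ, RelEuler.IsEntropyFluxKernel ε (RelEuler.entropyKernel R) σ →
        ∀ φ, RelEuler.IsTestFunction RelEuler.nonunitDensity φ →
          (-∫ p, RelEuler.sharp (RelEuler.entropyKernel R) σ p * RelEuler.dw φ p =
            (∫ z, RelEuler.C5 ε z * Real.exp (-(1 + ε) ^ 2 * z / 4) * φ (0, z)) +
              ∫ p in {p : ℝ × ℝ | p.1 * p.2 < 0}, RelEuler.C3 ε R p * φ p) ∧
          (-∫ p, RelEuler.sharp (RelEuler.entropyKernel R) σ p * RelEuler.dz φ p =
            (∫ w, RelEuler.C6 ε w * Real.exp ((1 - ε) ^ 2 * w / 4) * φ (w, 0)) +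
              ∫ p in {p : ℝ × ℝ | p.1 * p.2 < 0}, RelEuler.C4 ε R p * φ p) := by
  refine ⟨RelEuler.existsUnique_isRiemannFunction hε0 hε1, fun R hR => ?_⟩
  obtain ⟨F, hF⟩ := (hR.isGoursatSolution hε0 hε1 0 0).exists_isFlux
    (RelEuler.hasDerivAt_lam1 hε0 hε1) (RelEuler.hasDerivAt_lam2 hε0 hε1)
  have hF_kernel := hR.isEntropyFluxKernel_fluxKernel hε0 hε1 hF
  refine ⟨hR.contDiff_pole hε0 hε1 0 0, ⟨_, hF_kernel⟩, fun σ σ' hσ hσ' => hσ.ae_eq hσ',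
    fun σ hσ φ hφ => ?_⟩
  simp only [hσ.integral_sharp_mul_eq hF_kernel]
  exact ⟨hR.integral_sharp_mul_dw hε0 hε1 hF hφ, hR.integral_sharp_mul_dz hε0 hε1 hF hφ⟩
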